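/- Let $p$ be a prime and let $R$ be a finite extension of the ring $\mathbb{Z}_p$ of $p$-adic integers, i.e. a discrete valuation ring that contains $\mathbb{Z}_p$ and is finitely generated as a $\mathbb{Z}_p$-module, with its $\mathfrak m$-adic topology, where $\mathfrak m$ is the maximal ideal. Let $f=[R/\mathfrak m:\mathbb{F}_p]$ be the inertia degree and $e$ the ramification index of $R$, defined by $pR=\mathfrak m^e$, and put $n=ef$. Let $H(R)$ be the group of upper unitriangular $3\times 3$ matrices over $R$. For a topological group $G$ let $a_m^{\triangleleft}(G)$ be the number of open normal subgroups of index $m$ in $G$, and let $\zeta_G^{\triangleleft}(s)=\sum_{m\ge 1}a_m^{\triangleleft}(G)m^{-s}$; write $\zeta_{\mathbb{Z}_p^{2n}}(s)$ for this series for $G=\mathbb{Z}_p^{2n}$. Let $s_i=(i\;\,i+1)$ for $1\le i\le n-1$. For $w\in S_n$ let $\ell(w)$ be the length of a shortest word in $s_1,\dots,s_{n-1}$ representing $w$, let $\ell^{[n-2]}(w)$ be the minimum of $\ell$ on the coset $w\langle s_1,\dots,s_{n-2}\rangle$, and let $\mathrm{Des}(w)=\{i : 1\le i\le n-1,\ \ell(ws_i)<\ell(w)\}$.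 For $0\le i\le n-1$ let $x_i=p^{(2n+i)(n-i)-(3n-i)s}$. Then $a_m^{\triangleleft}(H(R))$ is finite for every $m\ge 1$, and for every complex $s$ with $\operatorname{Re}(s)>2n-1$ both series $\zeta_{H(R)}^{\triangleleft}(s)$ and $\zeta_{\mathbb{Z}_p^{2n}}(s)$ converge absolutely, the numbers $1-x_i$ are nonzero, and $$\zeta_{H(R)}^{\triangleleft}(s)=\zeta_{\mathbb{Z}_p^{2n}}(s)\,\frac{\sum_{w\in S_n}p^{-\ell(w)+2f\left\lfloor \ell^{[n-2]}(w)/f\right\rfloor s}\prod_{j\in \mathrm{Des}(w)}x_j}{\prod_{i=0}^{n-1}(1-x_i)}.$$ -/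

import Mathlib

/-! ### Normal zeta functions of topological groups -/

/-- The open normal subgroups of index `m` of a topological group `G`. -/
def openNormalSubgroups (G : Type*) [Group G] [TopologicalSpace G] (m : ℕ) : Set (Subgroup G) :=
  {N | N.Normal ∧ IsOpen (N : Set G) ∧ N.index = m}

/-- The number of open normal subgroups of index `m` of `G`. -/
noncomputable def normalCount (G : Type*) [Group G] [TopologicalSpace G] (m : ℕ) : ℕ :=
  (openNormalSubgroups G m).ncard

/-- The coefficient sequence of the normal zeta function. The value at `m = 0` is irrelevant, since
Dirichlet series only involve the terms with `m ≥ 1`. -/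
noncomputable def normalCoeff (G : Type*) [Group G] [TopologicalSpace G] : ℕ → ℂ :=
  fun m => (normalCount G m : ℂ)

/-- The normal zeta function `∑_{m ≥ 1} a_m m ^ (-s)`, where `a_m` is the number of open normal
subgroups of index `m` of `G`. -/
noncomputable def normalZeta (G : Type*) [Group G] [TopologicalSpace G] (s : ℂ) : ℂ :=
  LSeries (normalCoeff G) s

/-! ### The Heisenberg group -/

/-- The Heisenberg group over `R`: the upper unitriangular `3 × 3` matrices over `R` (their
determinant is automatically `1`), with the topology induced by that of `R`. -/
def heisenbergGroup (R : Type*) [CommRing R] : Subgroup (Matrix.SpecialLinearGroup (Fin 3) R) where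
  carrier := {M | (∀ i, M i i = 1) ∧ ∀ i j, j < i → M i j = 0}
  one_mem' := by
    refine ⟨fun i => by simp, fun i j hij => ?_⟩
    simp [Matrix.one_apply_ne hij.ne']
  mul_mem' := by
    rintro A B ⟨hA, hA'⟩ ⟨hB, hB'⟩
    refine ⟨fun i => ?_, fun i j hij => ?_⟩
    · fin_cases i <;>
        simp [Matrix.mul_apply, Fin.sum_univ_three, hA, hB, hA', hB']
    · fin_cases i <;> fin_cases j <;>
        simp_all [Matrix.mul_apply, Fin.sum_univ_three]
  inv_mem' := by
    rintro A ⟨hA, hA'⟩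
    refine ⟨fun i => ?_, fun i j hij => ?_⟩
    · fin_cases i <;>
        simp [Matrix.SpecialLinearGroup.coe_inv, Matrix.adjugate_fin_three, hA, hA']
    · fin_cases i <;> fin_cases j <;>
        simp_all [Matrix.SpecialLinearGroup.coe_inv, Matrix.adjugate_fin_three]

/-! ### The symmetric group as a Coxeter group -/

/-- The adjacent transposition of the `i`-th and `(i+1)`-st letters. The letters `1, …, n` are
represented by `Fin n`, and the generators `s_1, …, s_{n-1}` by `Fin (n - 1)`, so both have their
labels shifted by one. -/
def simpleTransposition {n : ℕ} (i : Fin (n - 1)) : Equiv.Perm (Fin n) :=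
  Equiv.swap ⟨i, by omega⟩ ⟨i + 1, by omega⟩

/-- Every permutation is a product of adjacent transpositions. -/
theorem exists_word {n : ℕ} (w : Equiv.Perm (Fin n)) :
    ∃ l : List (Fin (n - 1)), (l.map simpleTransposition).prod = w := by
  cases n with
  | zero => exact ⟨[], Subsingleton.elim _ _⟩
  | succ n =>
    have hw : w ∈ Submonoid.closure
        (Set.range fun i : Fin n => Equiv.swap i.castSucc i.succ) := by
      rw [Equiv.Perm.mclosure_swap_castSucc_succ]; trivial
    induction hw using Submonoid.closure_induction with
    | mem x hx =>
      obtain ⟨i, rfl⟩ := hx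
      exact ⟨[i], by simp [simpleTransposition]; rfl⟩
    | one => exact ⟨[], rfl⟩
    | mul x y _ _ hx hy =>
      obtain ⟨l, rfl⟩ := hx
      obtain ⟨k, rfl⟩ := hy
      exact ⟨l ++ k, by simp⟩

/-- The Coxeter length: the length of a shortest word in the adjacent transpositions that
represents `w`. -/
noncomputable def coxeterLength {n : ℕ} (w : Equiv.Perm (Fin n)) : ℕ :=
  sInf {k | ∃ l : List (Fin (n - 1)), l.length = k ∧ (l.map simpleTransposition).prod = w}

/-- The parabolic subgroup generated by the adjacent transpositions with index in `I`. -/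
def parabolicSubgroup {n : ℕ} (I : Set (Fin (n - 1))) : Subgroup (Equiv.Perm (Fin n)) :=
  Subgroup.closure (simpleTransposition '' I)

/-- The (right) parabolic length of `w` with respect to `I`: the Coxeter length of the shortest
element of the coset `w W_I`. -/
noncomputable def parabolicLength {n : ℕ} (I : Set (Fin (n - 1))) (w : Equiv.Perm (Fin n)) : ℕ :=
  sInf {k | ∃ v ∈ parabolicSubgroup I, coxeterLength (w * v) = k}

/-- The parabolic length with respect to the generators `s_1, …, s_{n-2}`, that is, to all
generators but the last one. -/
noncomputable def lastParabolicLength {n : ℕ} (w : Equiv.Perm (Fin n)) : ℕ :=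
  parabolicLength {i : Fin (n - 1) | (i : ℕ) + 1 ≤ n - 2} w

open Classical in
/-- The (right) descent set of `w`. -/
noncomputable def descentSet {n : ℕ} (w : Equiv.Perm (Fin n)) : Finset (Fin (n - 1)) :=
  Finset.univ.filter fun i => coxeterLength (w * simpleTransposition i) < coxeterLength w

/-! ### Numerical data -/

/-- `x_i = p ^ ((2n + i)(n - i) - (3n - i) s)`. -/
noncomputable def numericalDatum (p n : ℕ) (s : ℂ) (i : ℕ) : ℂ :=
  (p : ℂ) ^ ((2 * (n : ℂ) + i) * ((n : ℂ) - i) - (3 * (n : ℂ) - i) * s)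

/-!
The subgroup `H(R)` is the set `R³` with the product
`(a, b, c) (a', b', c') = (a + a', b + b', c + c' + a b')`. If `N` is an open normal subgroup, then
commutators show that `N` contains `(0, 0, r a)` and `(0, 0, r b)` for all `(a, b, c) ∈ N` and
`r ∈ R`, so the cocycle `a b'` takes values in `N`. Hence `N` is also a `ℤ_[p]`-submodule of `R³`,
with the same index (`exists_openNormalEquiv`). Such a submodule is determined by its intersection
`L` with the centre, its projection to `R²`, and a gluing homomorphism from this projection to
`R ⧸ L`. The condition on commutators says that the projection lies in the square of the largest
ideal `𝔪 ^ c(L)` contained in `L`, which is a free `ℤ_[p]`-module of rank `2n`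
(`exists_gluingEquiv`). So each lattice `L` in `R` occurs with every lattice in `ℤ_[p] ^ (2n)`, with
`[R : L] ^ (2n)` gluing homomorphisms each, and the zeta function of `H(R)` is the product of the
zeta function of `ℤ_[p] ^ (2n)` and of `∑_L [R : L] ^ (2n - s) p ^ (-2 f c(L) s)`
(`hasSum_heisenberg`).

The sum over `L` is evaluated in coordinates. `R` has a `ℤ_[p]`-basis for which the powers of `𝔪`
are every `f`-th member of the standard full lattice chain of `ℤ_[p]ⁿ` (`exists_coordinates`). The
steps of the chain at which a lattice `L` has elements are described by a vector `a ∈ ℕⁿ`, the type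
of `L`: they are the steps `i + n t` with `a i ≤ t`. The type determines `[R : L] = p ^ ∑ a i`
and `c(L)`, and the lattices of type `a` have unique reduced echelon generators, whose entries are
free digits (`echelonEquiv`). The permutation that sorts the numbers `i + n a i` turns the sum over
`a` into a sum over `S_n` of geometric series in the increments of the sorted vector (`sortEquiv`).
The increments are at least `1` at the descents of the permutation, its inversions correct the
number of free digits, and its last value determines the rounding in `c(L)`; this gives
`hasSum_lattices`. The inversions of a permutation are counted by its Coxeter length
(`coxeterLength_eq_card`), and its last value is given by the parabolic length
(`lastParabolicLength_add`).

All series are summed over index sets of subgroups and converge absolutely, which gives convergence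
of the Dirichlet series and finiteness of their coefficients (`lseriesHasSum_normalCoeff`).
-/

/-! ### Lattices in `ℤ_[p]ⁿ` -/

section Lattice

open Finset

variable {p : ℕ} [hp : Fact p.Prime] {n : ℕ}

/-- The standard full lattice chain `M_0 ⊃ M_1 ⊃ M_2 ⊃ ⋯` in `ℤ_[p]ⁿ`: `M_j` is spanned by the
vectors `p ^ t • e_i` with `j ≤ i + n * t`, so `M_{j + n} = p M_j` and each step has index `p`. -/
def latticeChain (p : ℕ) [Fact p.Prime] (n j : ℕ) : Submodule ℤ_[p] (Fin n → ℤ_[p]) where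
  carrier := {x | ∀ (i : Fin n) (t : ℕ), i + n * t < j → (p : ℤ_[p]) ^ (t + 1) ∣ x i}
  add_mem' hx hy i t h := dvd_add (hx i t h) (hy i t h)
  zero_mem' _ _ _ := dvd_zero _
  smul_mem' c _ hx i t h := (hx i t h).mul_left c

theorem mem_latticeChain {j : ℕ} {x : Fin n → ℤ_[p]} : x ∈ latticeChain p n j ↔
    ∀ (i : Fin n) (t : ℕ), i + n * t < j → (p : ℤ_[p]) ^ (t + 1) ∣ x i := Iff.rfl

theorem latticeChain_anti {j k : ℕ} (h : j ≤ k) : latticeChain p n k ≤ latticeChain p n j :=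
  fun _ hx i t ht => hx i t (ht.trans_le h)

@[simp] theorem latticeChain_zero : latticeChain p n 0 = ⊤ := by
  ext x; simp [mem_latticeChain]

theorem eq_of_add_mul_eq {i k : Fin n} {s t : ℕ} (h : (i : ℕ) + n * s = k + n * t) :
    i = k ∧ s = t := by
  have hi := i.2
  have hk := k.2
  have h1 : (i : ℕ) = k := by
    have := congrArg (· % n) h
    simpa [Nat.mod_eq_of_lt hi, Nat.mod_eq_of_lt hk] using this
  refine ⟨Fin.ext h1, ?_⟩
  rw [h1] at h
  exact Nat.eq_of_mul_eq_mul_left (by omega) (Nat.add_left_cancel h)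

theorem exists_add_mul_eq (hn : 0 < n) (j : ℕ) : ∃ (i : Fin n) (t : ℕ), (i : ℕ) + n * t = j :=
  ⟨⟨j % n, Nat.mod_lt _ hn⟩, j / n, Nat.mod_add_div j n⟩

theorem p_smul_mem_latticeChain_iff {j : ℕ} {x : Fin n → ℤ_[p]} :
    (p : ℤ_[p]) • x ∈ latticeChain p n (j + n) ↔ x ∈ latticeChain p n j := by
  have hp0 : (p : ℤ_[p]) ≠ 0 := by exact_mod_cast hp.out.ne_zero
  simp only [mem_latticeChain, Pi.smul_apply, smul_eq_mul]
  constructor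
  · intro h i t ht
    have := h i (t + 1) (by rw [mul_add]; omega)
    rw [pow_succ'] at this
    exact (mul_dvd_mul_iff_left hp0).1 this
  · intro h i t ht
    cases t with
    | zero => simp
    | succ t =>
      rw [pow_succ']
      exact mul_dvd_mul_left _ (h i t (by rw [mul_add] at ht; omega))

theorem p_pow_smul_mem_latticeChain_iff {j m : ℕ} {x : Fin n → ℤ_[p]} :
    (p : ℤ_[p]) ^ m • x ∈ latticeChain p n (j + n * m) ↔ x ∈ latticeChain p n j := by
  induction m generalizing j with
  | zero => simp
  | succ m ih => rw [pow_succ', mul_smul, mul_add, mul_one, ← add_assoc,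
      p_smul_mem_latticeChain_iff, ih]

theorem mem_latticeChain_iff_forall_dvd {k : ℕ} {x : Fin n → ℤ_[p]} :
    x ∈ latticeChain p n (n * k) ↔ ∀ i, (p : ℤ_[p]) ^ k ∣ x i := by
  rw [mem_latticeChain]
  constructor
  · intro h i
    cases k with
    | zero => simp
    | succ k => exact h i k (by rw [mul_add]; have := i.2; omega)
  · intro h i t ht
    refine (pow_dvd_pow _ ?_).trans (h i)
    have : n * t < n * k := by omega
    exact Nat.lt_of_mul_lt_mul_left this

/-- A nonzero vector leaves the chain at exactly one step `i + n * t`; this step, written as the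
pair `(i, t)`, is its leading position. -/
def IsLead (x : Fin n → ℤ_[p]) (i : Fin n) (t : ℕ) : Prop :=
  x ∈ latticeChain p n (i + n * t) ∧ x ∉ latticeChain p n (i + n * t + 1)

theorem pow_dvd_of_mem {i : Fin n} {t : ℕ} {x : Fin n → ℤ_[p]}
    (hx : x ∈ latticeChain p n (i + n * t)) : (p : ℤ_[p]) ^ t ∣ x i := by
  cases t with
  | zero => simp
  | succ t => exact hx i t (by rw [mul_add]; have := i.2; omega)

theorem mem_latticeChain_succ_iff {i : Fin n} {t : ℕ} {x : Fin n → ℤ_[p]} :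
    x ∈ latticeChain p n (i + n * t + 1) ↔
      x ∈ latticeChain p n (i + n * t) ∧ (p : ℤ_[p]) ^ (t + 1) ∣ x i := by
  refine ⟨fun h => ⟨latticeChain_anti (Nat.le_succ _) h, h i t (Nat.lt_succ_self _)⟩, ?_⟩
  rintro ⟨h, h'⟩ k s hs
  rcases (Nat.lt_succ_iff.1 hs).lt_or_eq with hs | hs
  · exact h k s hs
  · obtain ⟨rfl, rfl⟩ := eq_of_add_mul_eq hs
    exact h'

theorem isLead_iff {i : Fin n} {t : ℕ} {x : Fin n → ℤ_[p]} : IsLead x i t ↔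
    x ∈ latticeChain p n (i + n * t) ∧ ¬ (p : ℤ_[p]) ^ (t + 1) ∣ x i := by
  rw [IsLead, mem_latticeChain_succ_iff]; tauto

theorem exists_isLead {x : Fin n → ℤ_[p]} (hx : x ≠ 0) : ∃ i t, IsLead x i t := by
  classical
  obtain ⟨i, hi⟩ := Function.ne_iff.1 hx
  have hn : 0 < n := i.pos
  have : ∃ j, x ∉ latticeChain p n j := by
    by_contra! h
    refine hi ?_
    by_contra h0
    have h1 := fun k => mem_latticeChain_iff_forall_dvd.1 (h (n * k)) i
    have hf : FiniteMultiplicity (p : ℤ_[p]) (x i) :=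
      FiniteMultiplicity.of_not_isUnit PadicInt.prime_p.not_isUnit h0
    obtain ⟨k, hk⟩ := hf
    exact hk (h1 _)
  have h0 : Nat.find this ≠ 0 := by
    intro h
    have := Nat.find_spec this
    rw [h] at this
    simp at this
  obtain ⟨j, hj⟩ := Nat.exists_eq_succ_of_ne_zero h0
  obtain ⟨i, t, hit⟩ := exists_add_mul_eq hn j
  refine ⟨i, t, ?_, ?_⟩
  · rw [hit]
    by_contra h
    exact Nat.find_min this (hj ▸ Nat.lt_succ_self j) h
  · rw [hit, ← Nat.succ_eq_add_one, ← hj]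
    exact Nat.find_spec this

/-- A leading position is determined by membership in the chain. -/
theorem IsLead.mem_iff {x : Fin n → ℤ_[p]} {i : Fin n} {t j : ℕ} (h : IsLead x i t) :
    x ∈ latticeChain p n j ↔ j ≤ i + n * t := by
  refine ⟨fun hj => ?_, fun hj => latticeChain_anti hj h.1⟩
  by_contra! hlt
  exact h.2 (latticeChain_anti hlt hj)

theorem IsLead.unique {x : Fin n → ℤ_[p]} {i k : Fin n} {t s : ℕ} (h : IsLead x i t)
    (h' : IsLead x k s) : i = k ∧ t = s :=
  eq_of_add_mul_eq (le_antisymm (h'.mem_iff.1 h.1) (h.mem_iff.1 h'.1))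

theorem IsLead.smul {x : Fin n → ℤ_[p]} {i : Fin n} {t : ℕ} (h : IsLead x i t) {u : ℤ_[p]}
    (hu : IsUnit u) (m : ℕ) : IsLead ((u * (p : ℤ_[p]) ^ m) • x) i (t + m) := by
  have h1 : (i : ℕ) + n * (t + m) = i + n * t + n * m := by ring
  have h2 : (i : ℕ) + n * (t + m) + 1 = i + n * t + 1 + n * m := by ring
  rw [IsLead, mul_smul, Submodule.smul_mem_iff_of_isUnit _ hu,
    Submodule.smul_mem_iff_of_isUnit _ hu, h1,
    p_pow_smul_mem_latticeChain_iff, add_right_comm, p_pow_smul_mem_latticeChain_iff]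
  exact h

theorem exists_unit_mul_pow {c : ℤ_[p]} (hc : c ≠ 0) :
    ∃ (u : ℤ_[p]) (m : ℕ), IsUnit u ∧ c = u * (p : ℤ_[p]) ^ m :=
  ⟨_, _, (PadicInt.unitCoeff hc).isUnit, PadicInt.unitCoeff_spec hc⟩

theorem isLead_single (i : Fin n) (t : ℕ) :
    IsLead (Pi.single i ((p : ℤ_[p]) ^ t) : Fin n → ℤ_[p]) i t := by
  classical
  rw [isLead_iff]
  constructor
  · intro k s hs
    by_cases hk : k = i
    · subst hk
      rw [Pi.single_eq_same]
      exact pow_dvd_pow _ (Nat.lt_of_mul_lt_mul_left (a := n) (by omega))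
    · rw [Pi.single_eq_of_ne hk]; exact dvd_zero _
  · rw [Pi.single_eq_same, pow_dvd_pow_iff]
    · omega
    · exact PadicInt.prime_p.ne_zero
    · exact PadicInt.prime_p.not_isUnit

/-- The steps of the chain are one-dimensional: below a vector with leading position `(i, t)`,
every vector of `M_{i + n t}` can be moved into the next member of the chain. -/
theorem IsLead.exists_sub_smul_mem {x y : Fin n → ℤ_[p]} {i : Fin n} {t : ℕ} (hy : IsLead y i t)
    (hx : x ∈ latticeChain p n (i + n * t)) :
    ∃ c : ℕ, c < p ∧ x - (c : ℤ_[p]) • y ∈ latticeChain p n (i + n * t + 1) := by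
  obtain ⟨hy1, hy2⟩ := isLead_iff.1 hy
  obtain ⟨a, ha⟩ := pow_dvd_of_mem hx
  obtain ⟨b, hb⟩ := pow_dvd_of_mem hy1
  have hbu : IsUnit b := by
    by_contra h
    have : b ∈ IsLocalRing.maximalIdeal ℤ_[p] := (IsLocalRing.mem_maximalIdeal b).2 h
    rw [PadicInt.maximalIdeal_eq_span_p, Ideal.mem_span_singleton] at this
    exact hy2 (by rw [hb, pow_succ]; exact mul_dvd_mul_left _ this)
  obtain ⟨b', hb'⟩ := hbu.exists_right_inv
  refine ⟨(a * b').zmodRepr, PadicInt.zmodRepr_lt_p _, ?_⟩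
  rw [mem_latticeChain_succ_iff]
  refine ⟨sub_mem hx (Submodule.smul_mem _ _ hy1), ?_⟩
  have h1 := PadicInt.sub_zmodRepr_mem (a * b')
  rw [PadicInt.maximalIdeal_eq_span_p, Ideal.mem_span_singleton] at h1
  have : (x - ((a * b').zmodRepr : ℤ_[p]) • y) i =
      (p : ℤ_[p]) ^ t * ((a * b' - (a * b').zmodRepr) * b) := by
    simp only [Pi.sub_apply, Pi.smul_apply, smul_eq_mul, ha, hb]
    linear_combination (-a * (p : ℤ_[p]) ^ t) * hb'
  rw [this, pow_succ]
  exact mul_dvd_mul_left _ (h1.mul_right b)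

/-- A submodule of `ℤ_[p]ⁿ` has type `a` if the leading positions of its vectors are the `(i, t)`
with `a i ≤ t`. -/
def HasType (L : Submodule ℤ_[p] (Fin n → ℤ_[p])) (a : Fin n → ℕ) : Prop :=
  ∀ i t, (∃ x ∈ L, IsLead x i t) ↔ a i ≤ t

theorem HasType.unique {L : Submodule ℤ_[p] (Fin n → ℤ_[p])} {a b : Fin n → ℕ}
    (ha : HasType L a) (hb : HasType L b) : a = b := by
  funext i
  exact le_antisymm ((ha i _).1 ((hb i _).2 le_rfl)) ((hb i _).1 ((ha i _).2 le_rfl))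

theorem exists_hasType {L : Submodule ℤ_[p] (Fin n → ℤ_[p])} {k : ℕ}
    (hk : ∀ x, (p : ℤ_[p]) ^ k • x ∈ L) : ∃ a, HasType L a := by
  classical
  have h : ∀ i : Fin n, ∃ t, ∃ x ∈ L, IsLead x i t := fun i =>
    ⟨k, Pi.single i ((p : ℤ_[p]) ^ k), by
      have := hk (Pi.single i 1)
      rwa [← Pi.single_smul, smul_eq_mul, mul_one] at this, isLead_single i k⟩
  refine ⟨fun i => Nat.find (h i), fun i t => ⟨fun ht => Nat.find_min' _ ht, fun ht => ?_⟩⟩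
  obtain ⟨x, hx, hl⟩ := Nat.find_spec (h i)
  have := hl.smul isUnit_one (t - Nat.find (h i))
  rw [Nat.add_sub_cancel' ht] at this
  exact ⟨_, L.smul_mem _ hx, this⟩

/-- A submodule `L` of `L'` with the same leading positions approximates all vectors of `L'`
along the chain. -/
theorem exists_approx {L L' : Submodule ℤ_[p] (Fin n → ℤ_[p])} (hn : 0 < n) (hle : L ≤ L')
    (h : ∀ i t, (∃ x ∈ L', IsLead x i t) → ∃ x ∈ L, IsLead x i t) {x : Fin n → ℤ_[p]}
    (hx : x ∈ L') (J : ℕ) : ∃ y ∈ L, x - y ∈ latticeChain p n J := by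
  induction J with
  | zero => exact ⟨0, L.zero_mem, by simp⟩
  | succ J ih =>
    obtain ⟨y, hy, hxy⟩ := ih
    by_cases hJ : x - y ∈ latticeChain p n (J + 1)
    · exact ⟨y, hy, hJ⟩
    obtain ⟨i, t, rfl⟩ := exists_add_mul_eq hn J
    obtain ⟨z, hz, hl⟩ := h i t ⟨x - y, sub_mem hx (hle hy), hxy, hJ⟩
    obtain ⟨c, -, hc⟩ := hl.exists_sub_smul_mem hxy
    exact ⟨y + (c : ℤ_[p]) • z, add_mem hy (L.smul_mem _ hz), by rwa [← sub_sub]⟩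

/-- A submodule with vectors of all leading positions from `J` on contains `M_J`: the difference is
absorbed by `p M_J = M_{J + n}`, and Nakayama's lemma applies. -/
theorem latticeChain_le {L : Submodule ℤ_[p] (Fin n → ℤ_[p])} (hn : 0 < n) {J : ℕ}
    (h : ∀ (i : Fin n) t, J ≤ i + n * t → ∃ x ∈ L, IsLead x i t) : latticeChain p n J ≤ L := by
  refine Submodule.le_of_le_smul_of_le_jacobson_bot (I := Ideal.span {(p : ℤ_[p])})
    (IsNoetherian.noetherian _) ?_ ?_
  · rw [← PadicInt.maximalIdeal_eq_span_p]
    exact IsLocalRing.maximalIdeal_le_jacobson _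
  · intro x hx
    obtain ⟨y, hy, hxy⟩ := exists_approx (L := L ⊓ latticeChain p n J) hn inf_le_right
      (fun i t hz => by
        obtain ⟨z, hz, hl⟩ := hz
        obtain ⟨w, hw, hl'⟩ := h i t (hl.mem_iff.1 hz)
        exact ⟨w, ⟨hw, hl'.mem_iff.2 (hl.mem_iff.1 hz)⟩, hl'⟩) hx (J + n)
    have h1 : ∃ z, x - y = (p : ℤ_[p]) • z := by
      have : ∀ i, (p : ℤ_[p]) ∣ (x - y) i := fun i => by
        simpa using hxy i 0 (by have := i.2; omega)
      choose z hz using this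
      exact ⟨z, funext hz⟩
    obtain ⟨z, hz⟩ := h1
    rw [← sub_add_cancel x y, add_comm]
    refine Submodule.add_mem_sup hy.1 ?_
    rw [hz]
    refine Submodule.smul_mem_smul (Ideal.mem_span_singleton_self _) ?_
    rwa [hz, p_smul_mem_latticeChain_iff] at hxy

theorem HasType.latticeChain_le_iff {L : Submodule ℤ_[p] (Fin n → ℤ_[p])} {a : Fin n → ℕ}
    (hn : 0 < n) (h : HasType L a) {J : ℕ} :
    latticeChain p n J ≤ L ↔ ∀ i : Fin n, i + n * a i < J + n := by
  constructor
  · intro hle i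
    by_contra! hi
    have ha : a i ≠ 0 := by
      intro h0
      rw [h0] at hi
      have := i.2
      omega
    obtain ⟨t, ht⟩ := Nat.exists_eq_succ_of_ne_zero ha
    rw [ht, Nat.succ_eq_add_one, mul_add] at hi
    have := (h i t).1 ⟨_, hle ((isLead_single i t).mem_iff.2 (by omega)), isLead_single i t⟩
    omega
  · intro hi
    refine latticeChain_le hn fun i t ht => (h i t).2 ?_
    have h1 : n * a i < n * (t + 1) := by rw [mul_add]; have := hi i; omega
    exact Nat.lt_succ_iff.1 (Nat.lt_of_mul_lt_mul_left h1)

theorem HasType.exists_latticeChain_le {L : Submodule ℤ_[p] (Fin n → ℤ_[p])} {a : Fin n → ℕ}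
    (hn : 0 < n) (h : HasType L a) : ∃ k, latticeChain p n (n * k) ≤ L := by
  refine ⟨∑ i, a i, (h.latticeChain_le_iff hn).2 fun i => ?_⟩
  have := Finset.single_le_sum (f := a) (fun _ _ => Nat.zero_le _) (Finset.mem_univ i)
  have := Nat.mul_le_mul_left n this
  have := i.2
  omega

theorem HasType.exists_pow_smul_mem {L : Submodule ℤ_[p] (Fin n → ℤ_[p])} {a : Fin n → ℕ}
    (hn : 0 < n) (h : HasType L a) : ∃ k, ∀ x, (p : ℤ_[p]) ^ k • x ∈ L := by
  obtain ⟨k, hk⟩ := h.exists_latticeChain_le hn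
  exact ⟨k, fun x => hk (mem_latticeChain_iff_forall_dvd.2 fun i => Dvd.intro _ rfl)⟩

theorem HasType.eq_of_le {L L' : Submodule ℤ_[p] (Fin n → ℤ_[p])} {a : Fin n → ℕ}
    (hn : 0 < n) (h : HasType L a) (h' : HasType L' a) (hle : L ≤ L') : L = L' := by
  refine le_antisymm hle fun x hx => ?_
  obtain ⟨k, hk⟩ := h.exists_latticeChain_le hn
  obtain ⟨y, hy, hxy⟩ := exists_approx hn hle
    (fun i t hz => (h i t).2 ((h' i t).1 hz)) hx (n * k)
  rw [← sub_add_cancel x y]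
  exact add_mem (hk hxy) hy

/-- Division with remainder modulo a lattice of type `a`, existence. -/
theorem HasType.exists_remainder {L : Submodule ℤ_[p] (Fin n → ℤ_[p])} {a : Fin n → ℕ}
    (hn : 0 < n) (h : HasType L a) (x : Fin n → ℤ_[p]) :
    ∃ r : Fin n → ℕ, (∀ k, r k < p ^ a k) ∧ (x - fun k => (r k : ℤ_[p])) ∈ L := by
  classical
  -- After step `J` the remainder uses only the digits at positions below `J`.
  have key : ∀ J : ℕ, ∃ (r : Fin n → ℕ) (l : Fin n → ℤ_[p]), l ∈ L ∧ (∀ k, r k < p ^ a k) ∧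
      (∀ (k : Fin n) (t : ℕ), J ≤ k + n * t → r k < p ^ t) ∧
      (x - fun k => (r k : ℤ_[p])) - l ∈ latticeChain p n J := by
    intro J
    induction J with
    | zero => exact ⟨0, 0, L.zero_mem, fun k => pow_pos hp.out.pos _,
        fun k t _ => pow_pos hp.out.pos _, by simp⟩
    | succ J ih =>
      obtain ⟨r, l, hl, hr, hr', hx⟩ := ih
      obtain ⟨i, t, rfl⟩ := exists_add_mul_eq hn J
      by_cases ha : a i ≤ t
      · obtain ⟨z, hz, hlz⟩ := (h i t).2 ha
        obtain ⟨c, -, hc⟩ := hlz.exists_sub_smul_mem hx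
        refine ⟨r, l + (c : ℤ_[p]) • z, add_mem hl (L.smul_mem _ hz), hr,
          fun k s hs => hr' k s (by omega), by rwa [← sub_sub]⟩
      · obtain ⟨c, hcp, hc⟩ := (isLead_single i t).exists_sub_smul_mem hx
        have hlt : r i + c * p ^ t < p ^ (t + 1) := by
          have h1 := hr' i t le_rfl
          have h2 : (c + 1) * p ^ t ≤ p * p ^ t := Nat.mul_le_mul_right _ hcp
          rw [pow_succ']
          linarith [add_mul c 1 (p ^ t)]
        have hpp := hp.out.pos
        refine ⟨Function.update r i (r i + c * p ^ t), l, hl, fun k => ?_, fun k s hs => ?_, ?_⟩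
        · by_cases hk : k = i
          · subst hk
            rw [Function.update_self]
            exact hlt.trans_le (Nat.pow_le_pow_right hpp (by omega))
          · rw [Function.update_of_ne hk]; exact hr k
        · by_cases hk : k = i
          · subst hk
            rw [Function.update_self]
            refine hlt.trans_le (Nat.pow_le_pow_right hpp ?_)
            exact Nat.lt_of_mul_lt_mul_left (a := n) (by omega)
          · rw [Function.update_of_ne hk]; exact hr' k s (by omega)
        · convert! hc using 1
          funext k
          by_cases hk : k = i
          · subst hk
            simp only [Pi.sub_apply, Function.update_self, Pi.smul_apply, Pi.single_eq_same,
              smul_eq_mul]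
            push_cast
            ring
          · simp [Function.update_of_ne hk, Pi.single_eq_of_ne hk]
  obtain ⟨k, hk⟩ := h.exists_latticeChain_le hn
  obtain ⟨r, l, hl, hr, -, hx⟩ := key (n * k)
  exact ⟨r, hr, by simpa using add_mem (hk hx) hl⟩

/-- Division with remainder modulo a lattice of type `a`, uniqueness. -/
theorem HasType.eq_zero_of_mem {L : Submodule ℤ_[p] (Fin n → ℤ_[p])} {a : Fin n → ℕ}
    (h : HasType L a) {x : Fin n → ℤ_[p]} (hx : x ∈ L)
    (hx' : ∀ k, (p : ℤ_[p]) ^ a k ∣ x k → x k = 0) : x = 0 := by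
  by_contra h0
  obtain ⟨i, t, hl⟩ := exists_isLead h0
  have hat := (h i t).1 ⟨x, hx, hl⟩
  have h1 := hx' i ((pow_dvd_pow _ hat).trans (pow_dvd_of_mem hl.1))
  exact (isLead_iff.1 hl).2 (h1 ▸ dvd_zero _)

theorem natCast_eq_of_pow_dvd_sub {r s m : ℕ} (hr : r < p ^ m) (hs : s < p ^ m)
    (h : (p : ℤ_[p]) ^ m ∣ (r : ℤ_[p]) - s) : r = s := by
  have h1 : ((p ^ m : ℕ) : ℤ) ∣ (r : ℤ) - s := by
    have := (PadicInt.pow_p_dvd_int_iff m ((r : ℤ) - s)).1 (by push_cast; exact h)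
    exact_mod_cast this
  have h2 := Int.eq_zero_of_abs_lt_dvd h1 (by rw [abs_lt]; omega)
  omega

/-- The index of a lattice of type `a` is `p ^ ∑ i, a i`. -/
theorem HasType.card_quotient {L : Submodule ℤ_[p] (Fin n → ℤ_[p])} {a : Fin n → ℕ}
    (hn : 0 < n) (h : HasType L a) :
    Nat.card ((Fin n → ℤ_[p]) ⧸ L) = p ^ ∑ i, a i := by
  have hb : Function.Bijective (fun r : (∀ k, Fin (p ^ a k)) =>
      L.mkQ (fun k => ((r k : ℕ) : ℤ_[p]))) := by
    constructor
    · intro r s hrs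
      have h1 := (Submodule.Quotient.eq L).1 hrs
      have h2 := h.eq_zero_of_mem h1 fun k hk => by
        simp only [Pi.sub_apply] at hk ⊢
        rw [natCast_eq_of_pow_dvd_sub (r k).2 (s k).2 hk, sub_self]
      funext k
      refine Fin.ext (natCast_eq_of_pow_dvd_sub (r k).2 (s k).2 ?_)
      have := congrFun h2 k
      simp only [Pi.sub_apply, Pi.zero_apply] at this
      rw [this]
      exact dvd_zero _
    · intro x
      obtain ⟨x, rfl⟩ := L.mkQ_surjective x
      obtain ⟨r, hr, hx⟩ := h.exists_remainder hn x
      exact ⟨fun k => ⟨r k, hr k⟩, ((Submodule.Quotient.eq L).2 hx).symm⟩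
  rw [← Nat.card_congr (Equiv.ofBijective _ hb)]
  simp [Finset.prod_pow_eq_pow_sum]

end Lattice

/-! ### Reduced echelon generators -/

section Echelon

open Finset

variable {p : ℕ} {n : ℕ}

/-- The first power of `p` that a reduced echelon generator of leading position `(i, a i)` may have
at its coordinate `k`: smaller powers would come before the leading position in the chain. -/
def firstDigit (a : Fin n → ℕ) (i k : Fin n) : ℕ := a i + if k < i then 1 else 0

/-- The parameters of the lattices of type `a`: the entries of the reduced echelon generators. -/
abbrev EchelonData (p : ℕ) {n : ℕ} (a : Fin n → ℕ) : Type :=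
  ∀ i k : Fin n, Fin (p ^ (a k - firstDigit a i k))

theorem card_echelonData (a : Fin n → ℕ) :
    Fintype.card (EchelonData p a) = p ^ ∑ i, ∑ k, (a k - firstDigit a i k) := by
  simp [Finset.prod_pow_eq_pow_sum]

theorem EchelonData.diag_eq_zero {a : Fin n → ℕ} (c : EchelonData p a) (i : Fin n) :
    (c i i : ℕ) = 0 := by
  have h0 : a i - firstDigit a i i = 0 := by simp [firstDigit]
  exact Nat.lt_one_iff.1 ((c i i).2.trans_eq (by rw [h0, pow_zero]))

variable [hp : Fact p.Prime]

/-- The reduced echelon generator with leading position `(i, a i)`. -/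
noncomputable def echelonGen (a : Fin n → ℕ) (c : EchelonData p a) (i : Fin n) : Fin n → ℤ_[p] :=
  Pi.single i ((p : ℤ_[p]) ^ a i) -
    fun k => (((p ^ firstDigit a i k * (c i k : ℕ) : ℕ)) : ℤ_[p])

/-- The lattice spanned by reduced echelon generators. -/
noncomputable def echelonLattice (a : Fin n → ℕ) (c : EchelonData p a) :
    Submodule ℤ_[p] (Fin n → ℤ_[p]) :=
  Submodule.span ℤ_[p] (Set.range (echelonGen a c))

theorem firstDigit_mul_lt (a : Fin n → ℕ) (c : EchelonData p a) (i k : Fin n) :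
    p ^ firstDigit a i k * (c i k : ℕ) < p ^ a k := by
  have hpp := hp.out.pos
  by_cases h : firstDigit a i k ≤ a k
  · calc _ < p ^ firstDigit a i k * p ^ (a k - firstDigit a i k) :=
          Nat.mul_lt_mul_of_pos_left (c i k).2 (pow_pos hpp _)
      _ = _ := by rw [← pow_add, Nat.add_sub_cancel' h]
  · have h0 : a k - firstDigit a i k = 0 := by omega
    have h1 : (c i k : ℕ) < 1 := (c i k).2.trans_eq (by rw [h0, pow_zero])
    rw [Nat.lt_one_iff.1 h1, mul_zero]
    exact pow_pos hpp _

theorem isLead_echelonGen (a : Fin n → ℕ) (c : EchelonData p a) (i : Fin n) :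
    IsLead (echelonGen a c i) i (a i) := by
  rw [isLead_iff]
  constructor
  · refine sub_mem (isLead_single i (a i)).1 fun k t ht => ?_
    simp only [Nat.cast_mul, Nat.cast_pow]
    refine Dvd.dvd.mul_right (pow_dvd_pow _ ?_) _
    have h1 : t ≤ a i := by
      by_contra! h
      have := Nat.mul_le_mul_left n (Nat.succ_le_of_lt h)
      rw [Nat.succ_eq_add_one, mul_add] at this
      have := i.2
      omega
    rw [firstDigit]
    split_ifs with hk
    · omega
    · rcases h1.lt_or_eq with h1 | h1
      · omega
      · rw [h1] at ht
        exact absurd (Fin.lt_def.2 (by omega)) hk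
  · rw [echelonGen, Pi.sub_apply, Pi.single_eq_same, c.diag_eq_zero, mul_zero, Nat.cast_zero,
      sub_zero, pow_dvd_pow_iff PadicInt.prime_p.ne_zero PadicInt.prime_p.not_isUnit]
    omega

theorem IsLead.smul_mem_succ {g : Fin n → ℤ_[p]} {i k : Fin n} {s t : ℕ} (hg : IsLead g i s)
    (hik : i ≠ k) {c : ℤ_[p]} (h : c • g ∈ latticeChain p n (k + n * t)) :
    c • g ∈ latticeChain p n (k + n * t + 1) := by
  by_cases hc : c = 0
  · rw [hc, zero_smul]; exact zero_mem _
  obtain ⟨u, m, hu, rfl⟩ := exists_unit_mul_pow hc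
  have hl := hg.smul hu m
  rw [hl.mem_iff] at h ⊢
  rcases h.lt_or_eq with h | h
  · exact h
  · exact absurd (eq_of_add_mul_eq h).1.symm hik

/-- Vectors whose leading positions lie in distinct residue classes modulo `n` behave like an
orthogonal basis with respect to the chain. -/
theorem smul_mem_of_sum_smul_mem (hn : 0 < n) {g : Fin n → Fin n → ℤ_[p]} {a : Fin n → ℕ}
    (hg : ∀ i, IsLead (g i) i (a i)) {c : Fin n → ℤ_[p]} {J : ℕ}
    (h : ∑ i, c i • g i ∈ latticeChain p n J) (i : Fin n) : c i • g i ∈ latticeChain p n J := by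
  classical
  induction J generalizing i with
  | zero => simp
  | succ J ih =>
    have ih' := ih (latticeChain_anti (Nat.le_succ J) h)
    obtain ⟨k, t, rfl⟩ := exists_add_mul_eq hn J
    have h1 : ∀ i, i ≠ k → c i • g i ∈ latticeChain p n (k + n * t + 1) := fun i hi =>
      (hg i).smul_mem_succ hi (ih' i)
    by_cases hi : i = k
    · subst hi
      rw [← Finset.add_sum_erase _ _ (Finset.mem_univ i)] at h
      refine (Submodule.add_mem_iff_left _ (Submodule.sum_mem _ fun j hj => ?_)).1 h
      exact h1 j (Finset.ne_of_mem_erase hj)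
    · exact h1 i hi

theorem hasType_span (hn : 0 < n) {g : Fin n → Fin n → ℤ_[p]} {a : Fin n → ℕ}
    (hg : ∀ i, IsLead (g i) i (a i)) : HasType (Submodule.span ℤ_[p] (Set.range g)) a := by
  intro k t
  constructor
  · rintro ⟨x, hx, hl⟩
    obtain ⟨c, rfl⟩ := (Submodule.mem_span_range_iff_exists_fun _).1 hx
    have h1 := smul_mem_of_sum_smul_mem hn hg hl.1 k
    have h2 : c k • g k ∉ latticeChain p n (k + n * t + 1) := by
      intro h2
      refine hl.2 (Submodule.sum_mem _ fun i _ => ?_)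
      by_cases hi : i = k
      · rw [hi]; exact h2
      · exact (hg i).smul_mem_succ hi (smul_mem_of_sum_smul_mem hn hg hl.1 i)
    have hc : c k ≠ 0 := by
      rintro hc
      rw [hc, zero_smul] at h2
      exact h2 (zero_mem _)
    obtain ⟨u, m, hu, hm⟩ := exists_unit_mul_pow hc
    have h3 := (hg k).smul hu m
    rw [← hm] at h3
    have := (IsLead.unique h3 ⟨h1, h2⟩).2
    omega
  · intro ht
    have h1 := (hg k).smul isUnit_one (t - a k)
    rw [Nat.add_sub_cancel' ht] at h1
    exact ⟨_, Submodule.smul_mem _ _ (Submodule.subset_span ⟨k, rfl⟩), h1⟩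

theorem hasType_echelonLattice (hn : 0 < n) (a : Fin n → ℕ) (c : EchelonData p a) :
    HasType (echelonLattice a c) a :=
  hasType_span hn (isLead_echelonGen a c)

theorem echelonLattice_injective (hn : 0 < n) (a : Fin n → ℕ) :
    Function.Injective (echelonLattice (p := p) a) := by
  intro c d hcd
  funext i k
  have hpp := hp.out.pos
  have hc : echelonGen a c i ∈ echelonLattice a c := Submodule.subset_span ⟨i, rfl⟩
  have hd : echelonGen a d i ∈ echelonLattice a c := by
    rw [hcd]; exact Submodule.subset_span ⟨i, rfl⟩
  have h0 := (hasType_echelonLattice hn a c).eq_zero_of_mem (sub_mem hd hc) fun k hk => by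
    simp only [echelonGen, Pi.sub_apply, sub_sub_sub_cancel_left] at hk ⊢
    rw [natCast_eq_of_pow_dvd_sub (firstDigit_mul_lt a c i k) (firstDigit_mul_lt a d i k) hk,
      sub_self]
  have h1 := congrFun h0 k
  simp only [echelonGen, Pi.sub_apply, sub_sub_sub_cancel_left, Pi.zero_apply] at h1
  have h2 := natCast_eq_of_pow_dvd_sub (firstDigit_mul_lt a c i k) (firstDigit_mul_lt a d i k)
    (h1 ▸ dvd_zero _)
  exact Fin.ext (Nat.eq_of_mul_eq_mul_left (pow_pos hpp _) h2)

/-- The remainder of `p ^ a i • e_i` modulo a lattice of type `a` only involves positions behind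
`(i, a i)`, hence gives a reduced echelon generator. -/
theorem HasType.exists_echelonRow {L : Submodule ℤ_[p] (Fin n → ℤ_[p])} {a : Fin n → ℕ}
    (hn : 0 < n) (h : HasType L a) (i : Fin n) :
    ∃ c : ∀ k, Fin (p ^ (a k - firstDigit a i k)), (Pi.single i ((p : ℤ_[p]) ^ a i) -
      fun k => (((p ^ firstDigit a i k * (c k : ℕ) : ℕ)) : ℤ_[p])) ∈ L := by
  classical
  have hpp := hp.out.pos
  obtain ⟨r, hr, hx⟩ := h.exists_remainder hn (Pi.single i ((p : ℤ_[p]) ^ a i))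
  have hdvd : ∀ k t, (p : ℤ_[p]) ^ t ∣ (r k : ℤ_[p]) → p ^ t ∣ r k := fun k t hk => by
    have := (PadicInt.pow_p_dvd_int_iff t (r k : ℤ)).1 (by exact_mod_cast hk)
    exact_mod_cast this
  have hzero : ∀ k t, a k ≤ t → (p : ℤ_[p]) ^ t ∣ (r k : ℤ_[p]) → r k = 0 := fun k t hkt hk =>
    Nat.eq_zero_of_dvd_of_lt (hdvd k t hk) ((hr k).trans_le (Nat.pow_le_pow_right hpp hkt))
  have hmem : (fun k => (r k : ℤ_[p])) ∈ latticeChain p n (i + n * a i + 1) := by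
    by_cases h0 : (fun k => (r k : ℤ_[p])) = 0
    · rw [h0]; exact zero_mem _
    obtain ⟨k, t, hl⟩ := exists_isLead h0
    have hkt : t < a k := by
      by_contra! hkt
      exact (isLead_iff.1 hl).2 (by
        have := hzero k t hkt (pow_dvd_of_mem hl.1)
        simp [this])
    rw [hl.mem_iff]
    by_contra! hlt
    have hne : (k : ℕ) + n * t ≠ i + n * a i := by
      intro heq
      obtain ⟨rfl, rfl⟩ := eq_of_add_mul_eq heq
      exact lt_irrefl _ hkt
    have hlt' : (k : ℕ) + n * t + 1 ≤ i + n * a i := by omega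
    have hei := (isLead_single (p := p) i (a i))
    have : IsLead (Pi.single i ((p : ℤ_[p]) ^ a i) - fun k => (r k : ℤ_[p])) k t :=
      ⟨sub_mem (hei.mem_iff.2 (by omega)) hl.1, fun hh => hl.2
        ((Submodule.sub_mem_iff_right _ (hei.mem_iff.2 hlt')).1 hh)⟩
    exact absurd ((h k t).1 ⟨_, hx, this⟩) (by omega)
  have hfd : ∀ k, p ^ firstDigit a i k ∣ r k := by
    intro k
    apply hdvd
    obtain h0 | h0 := Nat.eq_zero_or_pos (firstDigit a i k)
    · rw [h0, pow_zero]; exact one_dvd _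
    obtain ⟨t, ht⟩ := Nat.exists_eq_succ_of_ne_zero h0.ne'
    rw [ht]
    refine hmem k t ?_
    rw [firstDigit] at ht
    split_ifs at ht with hk
    · have : t = a i := by omega
      subst this
      have := Fin.lt_def.1 hk
      omega
    · have : a i = t + 1 := by omega
      rw [this, mul_add]
      have := k.2
      omega
  choose c hc using hfd
  refine ⟨fun k => ⟨c k, ?_⟩, ?_⟩
  · by_contra! hck
    have h1 := hr k
    rw [hc] at h1
    by_cases hle : firstDigit a i k ≤ a k
    · have := Nat.mul_le_mul_left (p ^ firstDigit a i k) hck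
      rw [← pow_add, Nat.add_sub_cancel' hle] at this
      omega
    · have h2 : p ^ a k ≤ p ^ firstDigit a i k := Nat.pow_le_pow_right hpp (by omega)
      have h3 : 1 ≤ c k := (Nat.one_le_pow _ _ hpp).trans hck
      have := Nat.mul_le_mul_left (p ^ firstDigit a i k) h3
      omega
  · simp only [← hc]
    exact hx

theorem HasType.exists_eq_echelonLattice {L : Submodule ℤ_[p] (Fin n → ℤ_[p])} {a : Fin n → ℕ}
    (hn : 0 < n) (h : HasType L a) : ∃ c, echelonLattice a c = L := by
  choose c hc using fun i => h.exists_echelonRow hn i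
  refine ⟨c, (hasType_echelonLattice hn a c).eq_of_le hn h ?_⟩
  rw [echelonLattice, Submodule.span_le]
  rintro _ ⟨i, rfl⟩
  exact hc i

/-- The `ℤ_[p]`-submodules of finite index in a finitely generated module `M`, characterised as
those that contain `p ^ k M` for some `k`. -/
def Lattices (p : ℕ) [Fact p.Prime] (M : Type*) [AddCommGroup M] [Module ℤ_[p] M] : Type _ :=
  {L : Submodule ℤ_[p] M // ∃ k : ℕ, ∀ x : M, (p : ℤ_[p]) ^ k • x ∈ L}

/-- Lattices in `ℤ_[p]ⁿ` are classified by their types and their reduced echelon generators. -/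
noncomputable def echelonEquiv (p : ℕ) [Fact p.Prime] (hn : 0 < n) :
    (Σ a : Fin n → ℕ, EchelonData p a) ≃ Lattices p (Fin n → ℤ_[p]) :=
  Equiv.ofBijective
    (fun ac => ⟨echelonLattice ac.1 ac.2,
      (hasType_echelonLattice hn ac.1 ac.2).exists_pow_smul_mem hn⟩) <| by
    constructor
    · rintro ⟨a, c⟩ ⟨b, d⟩ h
      have h' : echelonLattice a c = echelonLattice b d := congrArg Subtype.val h
      have hab : a = b :=
        (hasType_echelonLattice hn a c).unique (h' ▸ hasType_echelonLattice hn b d)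
      subst hab
      rw [echelonLattice_injective hn a h']
    · rintro ⟨L, k, hk⟩
      obtain ⟨a, ha⟩ := exists_hasType hk
      obtain ⟨c, hc⟩ := ha.exists_eq_echelonLattice hn
      exact ⟨⟨a, c⟩, Subtype.ext hc⟩

theorem hasType_echelonEquiv (hn : 0 < n) (a : Fin n → ℕ) (c : EchelonData p a) :
    HasType (echelonEquiv p hn ⟨a, c⟩).1 a :=
  hasType_echelonLattice hn a c

end Echelon

/-! ### Inversions and the length function of the symmetric group -/

section Permutations

open Finset

variable {n : ℕ}

/-- The inversions of a permutation: the pairs of positions `i < j` with `w j < w i`. -/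
def inversionSet (w : Equiv.Perm (Fin n)) : Finset (Fin n × Fin n) :=
  univ.filter fun x => x.1 < x.2 ∧ w x.2 < w x.1

theorem mem_inversionSet {w : Equiv.Perm (Fin n)} {x : Fin n × Fin n} :
    x ∈ inversionSet w ↔ x.1 < x.2 ∧ w x.2 < w x.1 := by
  simp [inversionSet]

theorem simpleTransposition_mul_self (i : Fin (n - 1)) :
    simpleTransposition i * simpleTransposition i = 1 :=
  Equiv.swap_mul_self _ _

theorem simpleTransposition_val (i : Fin (n - 1)) (x : Fin n) :
    (simpleTransposition i x : ℕ) =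
      if (x : ℕ) = i then (i : ℕ) + 1 else if (x : ℕ) = i + 1 then (i : ℕ) else x := by
  rw [simpleTransposition, Equiv.swap_apply_def]
  simp only [Fin.ext_iff]
  split_ifs <;> rfl

theorem simpleTransposition_involutive (i : Fin (n - 1)) (x : Fin n) :
    simpleTransposition i (simpleTransposition i x) = x := by
  rw [← Equiv.Perm.mul_apply, simpleTransposition_mul_self, Equiv.Perm.one_apply]

/-- Multiplying by the transposition of the positions `i, i + 1` creates the inversion `(i, i + 1)`
if this pair is not inverted yet, and permutes the other inversions. -/
theorem card_inversionSet_mul_of_lt {w : Equiv.Perm (Fin n)} {i : Fin (n - 1)} {a b : Fin n}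
    (ha : (a : ℕ) = i) (hb : (b : ℕ) = i + 1) (h : w a < w b) :
    (inversionSet (w * simpleTransposition i)).card = (inversionSet w).card + 1 := by
  classical
  have hsa : simpleTransposition i a = b := Fin.ext (by rw [simpleTransposition_val]; simp [ha, hb])
  have hsb : simpleTransposition i b = a := Fin.ext (by rw [simpleTransposition_val]; simp [ha, hb])
  have hmem : (a, b) ∈ inversionSet (w * simpleTransposition i) := by
    rw [mem_inversionSet]
    refine ⟨Fin.lt_def.2 (show (a : ℕ) < b by omega), ?_⟩
    simpa [hsa, hsb] using h
  have hs : ∀ x y : Fin n, x < y → (x, y) ≠ (a, b) →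
      simpleTransposition i x < simpleTransposition i y := by
    intro x y hxy hne
    rw [Ne, Prod.mk.injEq, Fin.ext_iff, Fin.ext_iff] at hne
    rw [Fin.lt_def] at hxy ⊢
    rw [simpleTransposition_val, simpleTransposition_val]
    split_ifs <;> omega
  rw [← Finset.card_erase_add_one hmem]
  congr 1
  symm
  refine Finset.card_bij' (fun x _ => (simpleTransposition i x.1, simpleTransposition i x.2))
    (fun x _ => (simpleTransposition i x.1, simpleTransposition i x.2)) ?_ ?_ ?_ ?_
  · rintro ⟨x, y⟩ hx
    rw [mem_inversionSet] at hx
    have hne : (x, y) ≠ (a, b) := by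
      rintro heq
      rw [Prod.mk.injEq] at heq
      rw [heq.1, heq.2] at hx
      exact lt_asymm h hx.2
    rw [Finset.mem_erase, mem_inversionSet]
    refine ⟨fun heq => ?_, hs x y hx.1 hne, ?_⟩
    · rw [Prod.mk.injEq] at heq
      have h1 : x = b := by rw [← simpleTransposition_involutive i x, heq.1, hsa]
      have h2 : y = a := by rw [← simpleTransposition_involutive i y, heq.2, hsb]
      have : (x : ℕ) < y := Fin.lt_def.1 hx.1
      rw [h1, h2] at this
      omega
    · simpa [simpleTransposition_involutive] using hx.2
  · rintro ⟨x, y⟩ hx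
    rw [Finset.mem_erase, mem_inversionSet] at hx
    rw [mem_inversionSet]
    exact ⟨hs x y hx.2.1 hx.1, by simpa using hx.2.2⟩
  · rintro ⟨x, y⟩ _
    simp [simpleTransposition_involutive]
  · rintro ⟨x, y⟩ _
    simp [simpleTransposition_involutive]

theorem card_inversionSet_mul_of_gt {w : Equiv.Perm (Fin n)} {i : Fin (n - 1)} {a b : Fin n}
    (ha : (a : ℕ) = i) (hb : (b : ℕ) = i + 1) (h : w b < w a) :
    (inversionSet (w * simpleTransposition i)).card + 1 = (inversionSet w).card := by
  have hsa : simpleTransposition i a = b := Fin.ext (by rw [simpleTransposition_val]; simp [ha, hb])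
  have hsb : simpleTransposition i b = a := Fin.ext (by rw [simpleTransposition_val]; simp [ha, hb])
  have := card_inversionSet_mul_of_lt (w := w * simpleTransposition i) ha hb
    (by simpa [hsa, hsb] using h)
  rw [mul_assoc, simpleTransposition_mul_self, mul_one] at this
  exact this.symm

theorem eq_one_of_strictMono {w : Equiv.Perm (Fin n)} (h : StrictMono w) : w = 1 := by
  have : h.orderIsoOfSurjective w w.surjective = OrderIso.refl _ := Subsingleton.elim _ _
  ext i
  exact congrArg Fin.val (congrArg (fun g : Fin n ≃o Fin n => g i) this)

theorem lt_of_forall_succ_lt {w : Fin n → Fin n} {m : ℕ}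
    (h : ∀ a b : Fin n, (b : ℕ) = a + 1 → (b : ℕ) < m → w a < w b) {a b : Fin n} (hab : a < b)
    (hb : (b : ℕ) < m) : w a < w b := by
  obtain ⟨b, hbn⟩ := b
  induction b with
  | zero => exact absurd (Fin.lt_def.1 hab) (by simp)
  | succ b ih =>
    have h1 := Fin.lt_def.1 hab
    have h2 := h ⟨b, by omega⟩ ⟨b + 1, hbn⟩ rfl hb
    rcases (Nat.lt_succ_iff.1 h1).lt_or_eq with h3 | h3
    · exact (ih (by omega) (Fin.lt_def.2 h3) (Nat.lt_of_succ_lt hb)).trans h2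
    · have : a = ⟨b, by omega⟩ := Fin.ext h3
      rwa [this]

theorem card_inversionSet_prod_le (l : List (Fin (n - 1))) :
    (inversionSet (l.map simpleTransposition).prod).card ≤ l.length := by
  induction l using List.reverseRecOn with
  | nil =>
    simp only [List.map_nil, List.prod_nil, List.length_nil, nonpos_iff_eq_zero,
      Finset.card_eq_zero]
    ext x
    rw [mem_inversionSet]
    simpa using fun h : x.1 < x.2 => h.le
  | append_singleton l i ih =>
    simp only [List.map_append, List.map_cons, List.map_nil, List.prod_append, List.prod_cons,
      List.prod_nil, mul_one, List.length_append, List.length_cons, List.length_nil, zero_add]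
    have ha : (i : ℕ) < n := by omega
    have hb : (i : ℕ) + 1 < n := by omega
    rcases lt_or_gt_of_ne (a := (l.map simpleTransposition).prod ⟨i, ha⟩)
      (b := (l.map simpleTransposition).prod ⟨i + 1, hb⟩)
      (fun h => by simp at h) with h | h
    · rw [card_inversionSet_mul_of_lt rfl rfl h]; omega
    · have := card_inversionSet_mul_of_gt rfl rfl h; omega

theorem exists_word_length_eq (w : Equiv.Perm (Fin n)) : ∃ l : List (Fin (n - 1)),
    l.length = (inversionSet w).card ∧ (l.map simpleTransposition).prod = w := by
  induction hk : (inversionSet w).card generalizing w with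
  | zero =>
    refine ⟨[], rfl, ?_⟩
    rw [Finset.card_eq_zero] at hk
    refine (eq_one_of_strictMono fun a b hab => ?_).symm
    refine lt_of_le_of_ne ?_ (fun h => hab.ne (w.injective h))
    by_contra! h
    have : (a, b) ∈ inversionSet w := mem_inversionSet.2 ⟨hab, h⟩
    rw [hk] at this
    simp at this
  | succ k ih =>
    obtain ⟨a, b, hb, hlt⟩ : ∃ a b : Fin n, (b : ℕ) = a + 1 ∧ w b < w a := by
      by_contra! h
      obtain ⟨⟨x, y⟩, hxy⟩ : (inversionSet w).Nonempty := by
        rw [← Finset.card_pos]; omega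
      rw [mem_inversionSet] at hxy
      refine absurd (lt_of_forall_succ_lt (w := w) (m := n) (fun a b hab _ => ?_) hxy.1 y.2)
        (lt_asymm hxy.2)
      refine lt_of_le_of_ne (h a b hab) fun heq => ?_
      have := congrArg Fin.val (w.injective heq)
      omega
    obtain ⟨l, hl, hw⟩ := ih (w * simpleTransposition ⟨a, by omega⟩) (by
      have := card_inversionSet_mul_of_gt (i := ⟨a, by omega⟩) rfl hb hlt
      omega)
    refine ⟨l ++ [⟨a, by omega⟩], by simp [hl], ?_⟩
    rw [List.map_append, List.prod_append, hw]
    simp [mul_assoc, simpleTransposition_mul_self]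

theorem coxeterLength_eq_card (w : Equiv.Perm (Fin n)) :
    coxeterLength w = (inversionSet w).card := by
  refine le_antisymm (Nat.sInf_le (exists_word_length_eq w)) ?_
  have hne : {k | ∃ l : List (Fin (n - 1)), l.length = k ∧
      (l.map simpleTransposition).prod = w}.Nonempty := ⟨_, exists_word_length_eq w⟩
  obtain ⟨l, hl, hw⟩ := Nat.sInf_mem hne
  rw [coxeterLength, ← hl, ← hw]
  exact card_inversionSet_prod_le l

theorem coxeterLength_mul_lt_iff {w : Equiv.Perm (Fin n)} {i : Fin (n - 1)} {a b : Fin n}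
    (ha : (a : ℕ) = i) (hb : (b : ℕ) = i + 1) :
    coxeterLength (w * simpleTransposition i) < coxeterLength w ↔ w b < w a := by
  rw [coxeterLength_eq_card, coxeterLength_eq_card]
  rcases lt_or_gt_of_ne (a := w a) (b := w b)
      (fun h => by have := congrArg Fin.val (w.injective h); omega) with h | h
  · rw [card_inversionSet_mul_of_lt ha hb h]
    simp [h.le]
  · rw [← card_inversionSet_mul_of_gt ha hb h]
    simp [h]

/-- The inversions involving the last position correspond to the values above `w (last m)`. -/
theorem card_image_last {m : ℕ} (w : Equiv.Perm (Fin (m + 1))) :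
    (((Finset.Ioi (w (Fin.last m))).image fun k => (w.symm k, Fin.last m)).card +
      w (Fin.last m) = m) ∧
    ((Finset.Ioi (w (Fin.last m))).image fun k => (w.symm k, Fin.last m)) ⊆ inversionSet w := by
  constructor
  · rw [Finset.card_image_of_injective _ fun x y h => by simpa using h, Fin.card_Ioi]
    omega
  · intro x hx
    obtain ⟨k, hk, rfl⟩ := Finset.mem_image.1 hx
    rw [Finset.mem_Ioi] at hk
    rw [mem_inversionSet]
    refine ⟨lt_of_le_of_ne (Fin.le_last _) fun h => ?_, by simpa using hk⟩
    have h' : w.symm k = Fin.last m := h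
    rw [← h', Equiv.apply_symm_apply] at hk
    exact lt_irrefl _ hk

/-- The shortest element of the coset of `w` has `w (last m)` as last value and increases on the
other positions. -/
theorem lastParabolicLength_add {m : ℕ} (w : Equiv.Perm (Fin (m + 1))) :
    lastParabolicLength w + w (Fin.last m) = m := by
  set I : Set (Fin (m + 1 - 1)) := {i | (i : ℕ) + 1 ≤ m + 1 - 2} with hI
  have hfix : ∀ v ∈ parabolicSubgroup (n := m + 1) I, v (Fin.last m) = Fin.last m := by
    intro v hv
    induction hv using Subgroup.closure_induction with
    | mem x hx =>
      obtain ⟨i, hi, rfl⟩ := hx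
      have hi' : (i : ℕ) + 1 ≤ m + 1 - 2 := hi
      apply Fin.ext
      rw [simpleTransposition_val, Fin.val_last]
      have := i.2
      split_ifs <;> omega
    | one => rfl
    | mul x y _ _ hx hy => rw [Equiv.Perm.mul_apply, hy, hx]
    | inv x _ hx => rw [Equiv.Perm.inv_eq_iff_eq, hx]
  have hne : {k | ∃ v ∈ parabolicSubgroup (n := m + 1) I, coxeterLength (w * v) = k}.Nonempty :=
    ⟨_, 1, one_mem _, rfl⟩
  obtain ⟨v, hv, hvk⟩ := Nat.sInf_mem hne
  have hmin : ∀ v' ∈ parabolicSubgroup (n := m + 1) I,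
      coxeterLength (w * v) ≤ coxeterLength (w * v') := fun v' hv' => by
    rw [hvk]; exact Nat.sInf_le ⟨v', hv', rfl⟩
  have hlast : (w * v) (Fin.last m) = w (Fin.last m) := by
    rw [Equiv.Perm.mul_apply, hfix v hv]
  have hlen : lastParabolicLength w = (inversionSet (w * v)).card := by
    rw [← coxeterLength_eq_card, hvk]; rfl
  have hmono : ∀ a b : Fin (m + 1), a < b → (b : ℕ) < m → (w * v) a < (w * v) b := by
    intro a b hab hb
    refine lt_of_forall_succ_lt (fun a b hab hb => ?_) hab hb
    have h1 := hmin (v * simpleTransposition ⟨a, by omega⟩) (mul_mem hv (Subgroup.subset_closure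
      ⟨⟨a, by omega⟩, show (a : ℕ) + 1 ≤ m + 1 - 2 by omega, rfl⟩))
    rw [← mul_assoc] at h1
    have h2 := (coxeterLength_mul_lt_iff (w := w * v) (i := ⟨a, by omega⟩) (a := a) (b := b)
      rfl hab).not.1 (not_lt.2 h1)
    refine lt_of_le_of_ne (not_lt.1 h2) fun h => ?_
    have := congrArg Fin.val ((w * v).injective h)
    omega
  obtain ⟨h1, h2⟩ := card_image_last (w * v)
  have heq : ((Finset.Ioi ((w * v) (Fin.last m))).image
      fun k => ((w * v).symm k, Fin.last m)) = inversionSet (w * v) := by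
    refine h2.antisymm fun x hx => ?_
    rw [mem_inversionSet] at hx
    have hx2 : x.2 = Fin.last m := by
      by_contra hne
      have : (x.2 : ℕ) ≠ m := fun h => hne (Fin.ext h)
      have hlt := hmono x.1 x.2 hx.1 (by have := x.2.2; omega)
      exact lt_asymm hlt hx.2
    rw [Finset.mem_image]
    refine ⟨(w * v) x.1, ?_, Prod.ext ?_ hx2.symm⟩
    · rw [Finset.mem_Ioi, ← hx2]; exact hx.2
    · exact (w * v).symm_apply_apply x.1
  rw [heq, hlast] at h1
  rw [hlen]
  exact h1

end Permutations

/-! ### Sorting exponent vectors -/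

section Sorting

open Finset

variable {m : ℕ}

/-- The indicator of the descents of `v`, shifted by one: its value at `j + 1` is `1` if
`v (j + 1) < v j`. -/
def descentIndicator (v : Equiv.Perm (Fin (m + 1))) : Fin (m + 1) → ℕ :=
  Fin.cases 0 fun j => if v j.succ < v j.castSucc then 1 else 0

/-- The exponent vector whose values, read in the order `v 0, v 1, …`, are the partial sums of
`D`. -/
def partialSums (v : Equiv.Perm (Fin (m + 1))) (D : Fin (m + 1) → ℕ) (i : Fin (m + 1)) : ℕ :=
  ∑ l ∈ Iic (v.symm i), D l

theorem partialSums_apply (v : Equiv.Perm (Fin (m + 1))) (D : Fin (m + 1) → ℕ)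
    (k : Fin (m + 1)) : partialSums v D (v k) = ∑ l ∈ Iic k, D l := by
  rw [partialSums, Equiv.symm_apply_apply]

theorem partialSums_apply_of_le (v : Equiv.Perm (Fin (m + 1))) (D : Fin (m + 1) → ℕ)
    {i k : Fin (m + 1)} (h : i ≤ k) :
    partialSums v D (v k) = partialSums v D (v i) + ∑ l ∈ Ioc i k, D l := by
  rw [partialSums_apply, partialSums_apply, ← Finset.sum_union]
  · congr 1
    ext l
    simp only [mem_union, mem_Iic, mem_Ioc]
    constructor
    · intro hl; rcases le_or_gt l i with h' | h'
      · exact Or.inl h'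
      · exact Or.inr ⟨h', hl⟩
    · rintro (hl | hl)
      · exact hl.trans h
      · exact hl.2
  · rw [Finset.disjoint_left]
    intro l hl hl'
    exact absurd (mem_Ioc.1 hl').1 (not_lt.2 (mem_Iic.1 hl))

/-- `v` increases along stretches without descents. -/
theorem lt_of_sum_descentIndicator_eq_zero {v : Equiv.Perm (Fin (m + 1))} {i k : Fin (m + 1)}
    (hik : i < k) (h : ∀ l ∈ Ioc i k, descentIndicator v l = 0) : v i < v k := by
  induction k using Fin.induction with
  | zero => exact absurd hik (Fin.not_lt_zero _)
  | succ k ih =>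
    have h1 : v k.castSucc < v k.succ := by
      have := h k.succ (mem_Ioc.2 ⟨hik, le_rfl⟩)
      rw [descentIndicator, Fin.cases_succ] at this
      refine lt_of_le_of_ne (not_lt.1 fun hlt => by simp [hlt] at this) fun heq => ?_
      exact (Fin.castSucc_lt_succ (i := k)).ne (v.injective heq)
    rcases (Fin.le_castSucc_iff.2 hik).lt_or_eq with h2 | h2
    · exact (ih h2 fun l hl => h l (mem_Ioc.2 ⟨(mem_Ioc.1 hl).1,
        (mem_Ioc.1 hl).2.trans Fin.castSucc_lt_succ.le⟩)).trans h1
    · rwa [h2]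

variable {v : Equiv.Perm (Fin (m + 1))} {D : Fin (m + 1) → ℕ}

theorem one_le_sum_Ioc (hD : ∀ l, descentIndicator v l ≤ D l) {i k : Fin (m + 1)} (hik : i < k)
    (h : v k < v i) : 1 ≤ ∑ l ∈ Ioc i k, D l := by
  by_contra! hlt
  have h0 := Finset.sum_eq_zero_iff.1 (Nat.lt_one_iff.1 hlt)
  exact lt_asymm h (lt_of_sum_descentIndicator_eq_zero hik fun l hl =>
    Nat.eq_zero_of_le_zero ((hD l).trans (h0 l hl).le))

/-- The permutation `v` sorts the positions `i + (m + 1) * a i`. -/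
theorem strictMono_partialSums (hD : ∀ l, descentIndicator v l ≤ D l) :
    StrictMono fun k => (v k : ℕ) + (m + 1) * partialSums v D (v k) := by
  intro i k hik
  have h1 := partialSums_apply_of_le v D hik.le
  have h2 := one_le_sum_Ioc hD hik
  have hi := (v i).2
  simp only
  rcases Nat.eq_zero_or_pos (∑ l ∈ Ioc i k, D l) with h0 | h0
  · rw [h1, h0, add_zero]
    have : v i < v k := by
      refine lt_of_le_of_ne (not_lt.1 fun h => ?_) fun h => hik.ne (v.injective h)
      have := h2 h
      omega
    have := Fin.lt_def.1 this
    omega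
  · have := Nat.mul_le_mul_left (m + 1) h0
    rw [h1, mul_add]
    omega

theorem eq_of_sum_Iic_eq {D E : Fin (m + 1) → ℕ} (h : ∀ k, ∑ l ∈ Iic k, D l = ∑ l ∈ Iic k, E l) :
    D = E := by
  funext k
  induction k using WellFoundedLT.induction with
  | ind k ih =>
    have h1 := h k
    rw [← Finset.Iio_insert, Finset.sum_insert (by simp), Finset.sum_insert (by simp),
      Finset.sum_congr rfl fun l hl => ih l (mem_Iio.1 hl)] at h1
    exact Nat.add_right_cancel h1

theorem exists_sum_Iic_eq (b δ : Fin (m + 1) → ℕ) (h0 : δ 0 = 0)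
    (h : ∀ j : Fin m, b j.castSucc + δ j.succ ≤ b j.succ) :
    ∃ d : Fin (m + 1) → ℕ, ∀ k, ∑ l ∈ Iic k, (d l + δ l) = b k := by
  refine ⟨Fin.cases (b 0) fun j => b j.succ - b j.castSucc - δ j.succ, fun k => ?_⟩
  induction k using Fin.induction with
  | zero =>
    have : Iic (0 : Fin (m + 1)) = {0} := by ext l; simp
    rw [this]
    simp [h0]
  | succ k ih =>
    have : Iic k.succ = insert k.succ (Iic k.castSucc) := by
      ext l
      rw [mem_insert, mem_Iic, mem_Iic, Fin.le_castSucc_iff, le_iff_eq_or_lt]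
    rw [this, Finset.sum_insert (by simp), ih]
    have := h k
    simp only [Fin.cases_succ]
    omega

/-- Exponent vectors correspond to pairs of a permutation, which sorts the positions
`i + (m + 1) * a i`, and a vector of increments. -/
noncomputable def sortEquiv (m : ℕ) :
    Equiv.Perm (Fin (m + 1)) × (Fin (m + 1) → ℕ) ≃ (Fin (m + 1) → ℕ) :=
  Equiv.ofBijective (fun vd => partialSums vd.1 (vd.2 + descentIndicator vd.1)) <| by
    constructor
    · rintro ⟨v, d⟩ ⟨w, e⟩ h
      simp only at h
      have hv := strictMono_partialSums (v := v) (D := d + descentIndicator v)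
        fun l => Nat.le_add_left _ _
      have hw := strictMono_partialSums (v := w) (D := e + descentIndicator w)
        fun l => Nat.le_add_left _ _
      rw [← h] at hw
      have hvw : v⁻¹ * w = 1 := by
        refine eq_one_of_strictMono fun i k hik => hv.lt_iff_lt.1 ?_
        simpa using hw hik
      have hvw' : v = w := (inv_mul_eq_one.1 hvw)
      subst hvw'
      have : d + descentIndicator v = e + descentIndicator v := eq_of_sum_Iic_eq fun k => by
        have := congrFun h (v k)
        rwa [partialSums_apply, partialSums_apply] at this
      rw [add_right_cancel this]
    · intro a
      have hinj : Function.Injective fun i : Fin (m + 1) => (i : ℕ) + (m + 1) * a i := by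
        intro i k h
        exact (eq_of_add_mul_eq h).1
      set v := Tuple.sort fun i : Fin (m + 1) => (i : ℕ) + (m + 1) * a i with hv
      have hmono := (Tuple.monotone_sort fun i : Fin (m + 1) => (i : ℕ) + (m + 1) * a i)
      obtain ⟨d, hd⟩ := exists_sum_Iic_eq (fun k => a (v k)) (descentIndicator v)
        (by simp [descentIndicator]) fun j => by
          have h1 := hmono (Fin.castSucc_lt_succ (i := j)).le
          simp only [Function.comp_apply, ← hv] at h1
          have h2 : a (v j.castSucc) ≤ a (v j.succ) := by
            by_contra! hlt
            have := Nat.mul_le_mul_left (m + 1) (Nat.succ_le_of_lt hlt)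
            rw [Nat.succ_eq_add_one, mul_add] at this
            have := (v j.succ).2
            omega
          rw [descentIndicator, Fin.cases_succ]
          split_ifs with hlt
          · refine Nat.succ_le_of_lt (lt_of_le_of_ne h2 fun heq => ?_)
            rw [heq] at h1
            have := Fin.lt_def.1 hlt
            omega
          · exact h2
      refine ⟨(v, d), funext fun i => ?_⟩
      have := hd (v.symm i)
      simp only [Equiv.apply_symm_apply] at this
      exact this

theorem sum_partialSums (v : Equiv.Perm (Fin (m + 1))) (D : Fin (m + 1) → ℕ) :
    ∑ i, partialSums v D i = ∑ l : Fin (m + 1), (m + 1 - l) * D l := by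
  rw [← Equiv.sum_comp v]
  simp only [partialSums_apply]
  rw [Finset.sum_comm' (t' := univ) (s' := fun l => Ici l) (by simp)]
  simp

theorem sum_sum_Ioc (D : Fin (m + 1) → ℕ) :
    ∑ i : Fin (m + 1), ∑ k : Fin (m + 1), ∑ l ∈ Ioc i k, D l =
      ∑ l : Fin (m + 1), l * (m + 1 - l) * D l := by
  have h1 : ∀ i : Fin (m + 1), ∑ k : Fin (m + 1), ∑ l ∈ Ioc i k, D l =
      ∑ l ∈ Ioi i, (m + 1 - l) * D l := fun i => by
    rw [Finset.sum_comm' (t' := Ioi i) (s' := fun l => Ici l)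
      (by simp [and_comm])]
    simp
  simp only [h1]
  rw [Finset.sum_comm' (t' := univ) (s' := fun l => Iio l) (by simp)]
  simp [mul_assoc]

/-- The number of free digits of the lattices whose type has the partial sums of `D` as values. -/
theorem sum_sum_sub_add_card (hD : ∀ l, descentIndicator v l ≤ D l) :
    (∑ i, ∑ k, (partialSums v D k - (partialSums v D i + if k < i then 1 else 0))) +
      (inversionSet v).card = ∑ l : Fin (m + 1), l * (m + 1 - l) * D l := by
  rw [← sum_sum_Ioc]
  have h1 : (inversionSet v).card =
      ∑ i, ∑ k, if i < k ∧ v k < v i then 1 else 0 := by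
    rw [inversionSet, Finset.card_filter, ← Finset.univ_product_univ, Finset.sum_product]
  have h2 : (∑ i, ∑ k, (partialSums v D k - (partialSums v D i + if k < i then 1 else 0))) =
      ∑ i, ∑ k, (partialSums v D (v k) -
        (partialSums v D (v i) + if v k < v i then 1 else 0)) := by
    rw [← Equiv.sum_comp v]
    exact Finset.sum_congr rfl fun i _ => (Equiv.sum_comp v _).symm
  rw [h1, h2, ← Finset.sum_add_distrib]
  refine Finset.sum_congr rfl fun i _ => ?_
  rw [← Finset.sum_add_distrib]
  refine Finset.sum_congr rfl fun k _ => ?_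
  rcases le_or_gt k i with hki | hik
  · have := partialSums_apply_of_le v D hki
    rw [if_neg (fun h : i < k ∧ v k < v i => absurd h.1 (not_lt.2 hki)),
      Finset.Ioc_eq_empty (not_lt.2 hki), Finset.sum_empty]
    omega
  · have h3 := partialSums_apply_of_le v D hik.le
    have h4 := one_le_sum_Ioc hD hik
    by_cases hlt : v k < v i
    · rw [if_pos hlt, if_pos ⟨hik, hlt⟩]
      have := h4 hlt
      omega
    · rw [if_neg hlt, if_neg (fun h : i < k ∧ v k < v i => hlt h.2)]
      omega

/-- The positions `i + (m + 1) * a i` all lie below a bound if the last one in sorted order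
does. -/
theorem forall_partialSums_lt_iff (hD : ∀ l, descentIndicator v l ≤ D l) {e f : ℕ}
    (hef : m + 1 = e * f) {c : ℕ} :
    (∀ i : Fin (m + 1), (i : ℕ) + (m + 1) * partialSums v D i < f * c + (m + 1)) ↔
      e * ∑ l, D l ≤ c + (m - v (Fin.last m)) / f := by
  have hf : 0 < f := by
    rcases Nat.eq_zero_or_pos f with rfl | h
    · omega
    · exact h
  have h1 : partialSums v D (v (Fin.last m)) = ∑ l, D l := by
    rw [partialSums_apply]
    congr 1
    ext l
    simp [Fin.le_last]
  have h2 := (v (Fin.last m)).2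
  have h3 : (∀ i : Fin (m + 1), (i : ℕ) + (m + 1) * partialSums v D i < f * c + (m + 1)) ↔
      (v (Fin.last m) : ℕ) + (m + 1) * ∑ l, D l < f * c + (m + 1) := by
    rw [← h1]
    refine ⟨fun h => h _, fun h i => lt_of_le_of_lt ?_ h⟩
    have := (strictMono_partialSums hD).monotone (Fin.le_last (v.symm i))
    simpa using this
  have h4 : ∀ x : ℕ, x ≤ (m - v (Fin.last m)) / f ↔ x * f ≤ m - v (Fin.last m) := fun x =>
    Nat.le_div_iff_mul_le hf
  have h5 := h4 (e * ∑ l, D l - c)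
  rw [Nat.sub_mul] at h5
  have h6 : (m + 1) * ∑ l, D l = (e * ∑ l, D l) * f := by
    generalize ∑ l, D l = S
    rw [hef]; ring
  have h7 : f * c = c * f := mul_comm _ _
  rw [h3, h6, h7, ← Nat.sub_le_iff_le_add', h5]
  omega

theorem div_le_mul_sum (hD : ∀ l, descentIndicator v l ≤ D l) {e f : ℕ} (hef : m + 1 = e * f) :
    (m - v (Fin.last m)) / f ≤ e * ∑ l, D l := by
  have hf : 0 < f := by
    rcases Nat.eq_zero_or_pos f with rfl | h
    · omega
    · exact h
  rcases Nat.eq_zero_or_pos (∑ l, D l) with h0 | h0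
  · have hD0 := Finset.sum_eq_zero_iff.1 h0
    have hv : v = 1 := eq_one_of_strictMono fun i k hik =>
      lt_of_sum_descentIndicator_eq_zero hik fun l _ =>
        Nat.eq_zero_of_le_zero ((hD l).trans (hD0 l (mem_univ _)).le)
    simp [hv]
  · calc (m - v (Fin.last m)) / f ≤ (m + 1) / f := Nat.div_le_div_right (by omega)
      _ = e := by rw [hef, Nat.mul_div_cancel _ hf]
      _ ≤ e * ∑ l, D l := Nat.le_mul_of_pos_right _ h0

end Sorting

/-! ### Generating functions of lattices -/

section GeneratingFunction

open Finset

theorem hasSum_sigma_const {α : Type*} {β : α → Type*} [∀ a, Fintype (β a)] {g : α → ℂ} {S : ℂ}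
    (h : HasSum (fun a => (Fintype.card (β a) : ℂ) * g a) S) :
    HasSum (fun x : Σ a, β a => g x.1) S := by
  have hs : Summable fun x : Σ a, β a => g x.1 := by
    rw [← summable_norm_iff, summable_sigma_of_nonneg fun _ => norm_nonneg _]
    refine ⟨fun a => (hasSum_fintype _).summable, ?_⟩
    refine h.summable.norm.congr fun a => ?_
    rw [tsum_fintype]
    simp
  have h2 := hs.hasSum.sigma fun a => hasSum_fintype fun b : β a => g a
  simp only [Finset.sum_const, Finset.card_univ, nsmul_eq_mul] at h2
  rw [h.unique h2]
  exact hs.hasSum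

theorem hasSum_fintype_prod {α β : Type*} [Fintype α] {g : α × β → ℂ} {S : α → ℂ}
    (h : ∀ a, HasSum (fun b => g (a, b)) (S a)) : HasSum g (∑ a, S a) := by
  have hs : Summable g := by
    rw [← summable_norm_iff, summable_prod_of_nonneg fun _ => norm_nonneg _]
    exact ⟨fun a => (h a).summable.norm, (hasSum_fintype _).summable⟩
  have := hs.hasSum.prod_fiberwise h
  rw [(hasSum_fintype S).unique this]
  exact hs.hasSum

/-- The multivariate geometric series. -/
theorem hasSum_prod_pow {n : ℕ} {x : Fin n → ℂ} (hx : ∀ i, ‖x i‖ < 1) :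
    HasSum (fun d : Fin n → ℕ => ∏ i, x i ^ d i) (∏ i, (1 - x i)⁻¹) := by
  induction n with
  | zero => simp
  | succ n ih =>
    have h1 := hasSum_geometric_of_norm_lt_one (hx 0)
    have h2 := ih fun i => hx i.succ
    have h3 := (summable_mul_of_summable_norm h1.summable.norm h2.summable.norm).hasSum
    rw [← tsum_mul_tsum_of_summable_norm h1.summable.norm h2.summable.norm, h1.tsum_eq,
      h2.tsum_eq] at h3
    rw [Fin.prod_univ_succ, ← (Fin.consEquiv fun _ : Fin (n + 1) => ℕ).hasSum_iff]
    refine h3.congr_fun fun d => ?_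
    simp [Fin.prod_univ_succ, Fin.consEquiv]

theorem prod_pow_descentIndicator {m : ℕ} (v : Equiv.Perm (Fin (m + 1))) (X : ℕ → ℂ) :
    ∏ l : Fin (m + 1), X l ^ descentIndicator v l = ∏ j ∈ descentSet v, X (j + 1) := by
  classical
  rw [Fin.prod_univ_succ, descentSet, Finset.prod_filter]
  simp only [descentIndicator, Fin.cases_zero, Fin.cases_succ, pow_zero, one_mul]
  refine Finset.prod_congr rfl fun j _ => ?_
  have := coxeterLength_mul_lt_iff (w := v) (i := j) (a := j.castSucc) (b := j.succ) rfl
    (Fin.val_succ j)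
  by_cases h : v j.succ < v j.castSucc
  · rw [if_pos h, if_pos (this.2 h), pow_one, Fin.val_succ]
  · rw [if_neg h, if_neg (this.not.2 h), pow_zero]

theorem prod_pow_eq {m : ℕ} (q z y : ℂ) (e : ℕ) (D : Fin (m + 1) → ℕ) :
    ∏ l : Fin (m + 1), (q ^ ((l : ℕ) * (m + 1 - l)) * z ^ (m + 1 - (l : ℕ)) * y ^ e) ^ D l =
      q ^ (∑ l : Fin (m + 1), (l : ℕ) * (m + 1 - l) * D l) *
        z ^ (∑ l : Fin (m + 1), (m + 1 - (l : ℕ)) * D l) * y ^ (e * ∑ l, D l) := by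
  simp only [mul_pow, ← pow_mul, Finset.prod_mul_distrib, Finset.prod_pow_eq_pow_sum,
    Finset.mul_sum]

variable {p : ℕ} [hp : Fact p.Prime] {m : ℕ}

/-- The generating function of the lattices `L` in `ℤ_[p]ⁿ` that records the index `p ^ v` and the
least `c` with `M_{f c} ≤ L`, where `f` divides `n = e f`. -/
theorem hasSum_lattices {e f : ℕ} (hef : m + 1 = e * f) {z y : ℂ} (hy : y ≠ 0) {X : ℕ → ℂ}
    (hX : ∀ l : Fin (m + 1),
      X l = (p : ℂ) ^ ((l : ℕ) * (m + 1 - l)) * z ^ (m + 1 - (l : ℕ)) * y ^ e)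
    (hX' : ∀ l : Fin (m + 1), ‖X l‖ < 1) {F : Lattices p (Fin (m + 1) → ℤ_[p]) → ℂ}
    (hF : ∀ (L : Lattices p (Fin (m + 1) → ℤ_[p])) (v c : ℕ),
      Nat.card ((Fin (m + 1) → ℤ_[p]) ⧸ L.1) = p ^ v →
      (∀ c', latticeChain p (m + 1) (f * c') ≤ L.1 ↔ c ≤ c') → F L = z ^ v * y ^ c) :
    HasSum F ((∑ w : Equiv.Perm (Fin (m + 1)), ((p : ℂ)⁻¹ ^ coxeterLength w *
      y⁻¹ ^ (lastParabolicLength w / f)) * ∏ j ∈ descentSet w, X (j + 1)) /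
        ∏ i ∈ range (m + 1), (1 - X i)) := by
  have hp0 : (p : ℂ) ≠ 0 := by exact_mod_cast hp.out.ne_zero
  have hn : 0 < m + 1 := Nat.succ_pos m
  -- the value of `F` on the lattices whose type has the partial sums of `D` as values
  have hFv : ∀ (v : Equiv.Perm (Fin (m + 1))) (D : Fin (m + 1) → ℕ),
      (∀ l, descentIndicator v l ≤ D l) → ∀ c : EchelonData p (partialSums v D),
      F (echelonEquiv p hn ⟨partialSums v D, c⟩) = z ^ (∑ i, partialSums v D i) *
        y ^ (e * ∑ l, D l - (m - v (Fin.last m)) / f) := by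
    intro v D hD c
    have ht := hasType_echelonEquiv hn (partialSums v D) c
    refine hF _ _ _ (ht.card_quotient hn) fun c' => ?_
    rw [ht.latticeChain_le_iff hn, forall_partialSums_lt_iff hD hef, tsub_le_iff_right]
  set G : (Fin (m + 1) → ℕ) → ℂ := fun a =>
    z ^ (∑ i, a i) * y ^ (e * ∑ l, (((sortEquiv m).symm a).2 l +
      descentIndicator ((sortEquiv m).symm a).1 l) -
        (m - ((sortEquiv m).symm a).1 (Fin.last m)) / f) with hG
  have hsort : ∀ a, partialSums ((sortEquiv m).symm a).1
      (((sortEquiv m).symm a).2 + descentIndicator ((sortEquiv m).symm a).1) = a := fun a =>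
    (sortEquiv m).apply_symm_apply a
  have hFG : ∀ x : Σ a : Fin (m + 1) → ℕ, EchelonData p a, F (echelonEquiv p hn x) = G x.1 := by
    rintro ⟨a, c⟩
    obtain ⟨v, D, hD, ha⟩ : ∃ v D, (∀ l, descentIndicator v l ≤ D l) ∧ partialSums v D = a ∧
        G a = z ^ (∑ i, a i) * y ^ (e * ∑ l, D l - (m - v (Fin.last m)) / f) :=
      ⟨_, _, fun l => Nat.le_add_left _ _, hsort a, rfl⟩
    obtain ⟨rfl, hGa⟩ := ha
    rw [hFv v D hD c, hGa]
  rw [← (echelonEquiv p hn).hasSum_iff]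
  have : F ∘ echelonEquiv p hn = fun x => G x.1 := funext hFG
  rw [this]
  refine hasSum_sigma_const ?_
  rw [← (sortEquiv m).hasSum_iff, Finset.sum_div]
  refine hasSum_fintype_prod fun v => ?_
  have hgeo := (hasSum_prod_pow hX').mul_left (((p : ℂ)⁻¹ ^ coxeterLength v *
      y⁻¹ ^ (lastParabolicLength v / f)) * ∏ j ∈ descentSet v, X (j + 1))
  rw [Finset.prod_inv_distrib, ← div_eq_mul_inv,
    Fin.prod_univ_eq_prod_range (fun i => 1 - X i)] at hgeo
  refine hgeo.congr_fun fun d => ?_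
  set D := d + descentIndicator v with hDdef
  have hD : ∀ l, descentIndicator v l ≤ D l := fun l => Nat.le_add_left _ _
  have hGD : G (sortEquiv m (v, d)) = z ^ (∑ i, partialSums v D i) *
      y ^ (e * ∑ l, D l - (m - v (Fin.last m)) / f) := by
    rw [hG]
    simp only [Equiv.symm_apply_apply]
    rfl
  have hcard := sum_sum_sub_add_card hD
  have hlen : lastParabolicLength v = m - v (Fin.last m) := by
    have := lastParabolicLength_add v
    omega
  have hE : Fintype.card (EchelonData p (sortEquiv m (v, d))) = p ^ (∑ i, ∑ k,
      (partialSums v D k - (partialSums v D i + if k < i then 1 else 0))) :=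
    card_echelonData _
  simp only [Function.comp_apply]
  rw [hGD, hE, ← prod_pow_descentIndicator v X, mul_assoc (_ * _), ← Finset.prod_mul_distrib]
  have hprod : ∏ l : Fin (m + 1), (X l ^ descentIndicator v l * X l ^ d l) =
      ∏ l : Fin (m + 1), X l ^ D l :=
    Finset.prod_congr rfl fun l _ => by
      rw [← pow_add, Nat.add_comm (descentIndicator v l)]; rfl
  rw [hprod, Finset.prod_congr rfl fun l _ => by rw [hX l], prod_pow_eq, ← hcard, sum_partialSums,
    coxeterLength_eq_card, hlen]
  have hy' : y ^ (e * ∑ l, D l) = y ^ (e * ∑ l, D l - (m - v (Fin.last m)) / f) *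
      y ^ ((m - v (Fin.last m)) / f) := by
    rw [← pow_add, Nat.sub_add_cancel (div_le_mul_sum hD hef)]
  rw [hy', pow_add, inv_pow, inv_pow]
  push_cast
  field_simp

end GeneratingFunction

/-! ### The maximal-adic filtration in coordinates -/

section Coordinates

open Finset IsLocalRing

variable {p : ℕ} [hp : Fact p.Prime] {R : Type*} [CommRing R] [Algebra ℤ_[p] R]

variable {e f : ℕ}

/-- Coordinates with respect to the products `π ^ k * θ l`, where `π` is a uniformizer. -/
noncomputable def monomialMap (π : R) (θ : Fin f → R) (e : ℕ) :
    (Fin (e * f) → ℤ_[p]) →ₗ[ℤ_[p]] R where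
  toFun x := ∑ k : Fin e, ∑ l : Fin f, x (finProdFinEquiv (k, l)) • (π ^ (k : ℕ) * θ l)
  map_add' x y := by simp [add_smul, Finset.sum_add_distrib]
  map_smul' c x := by simp [mul_smul, Finset.smul_sum]

theorem monomialMap_apply (π : R) (θ : Fin f → R) (e : ℕ) (x : Fin (e * f) → ℤ_[p]) :
    monomialMap π θ e x =
      ∑ k : Fin e, π ^ (k : ℕ) * ∑ l : Fin f, x (finProdFinEquiv (k, l)) • θ l := by
  simp [monomialMap, Finset.mul_sum]

variable [IsDomain R] [IsDiscreteValuationRing R]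

variable {π : R} {θ : Fin f → R}

theorem pow_mul_mem_pow_iff {k : ℕ} (hπ : maximalIdeal R = Ideal.span {π}) {x : R} {r : ℕ} :
    π ^ k * x ∈ maximalIdeal R ^ (k + r) ↔ x ∈ maximalIdeal R ^ r := by
  have hπ0 : π ≠ 0 := by
    rintro rfl
    rw [Ideal.span_singleton_eq_bot.2 rfl] at hπ
    exact IsDiscreteValuationRing.not_a_field R hπ
  rw [hπ, Ideal.span_singleton_pow, Ideal.span_singleton_pow, Ideal.mem_span_singleton,
    Ideal.mem_span_singleton, pow_add, mul_dvd_mul_iff_left (pow_ne_zero _ hπ0)]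

/-- Below the power `e`, membership in a power of the maximal ideal only depends on the
coordinates modulo `p`. -/
theorem monomialMap_mem_pow_iff_of_le (hπ : maximalIdeal R = Ideal.span {π})
    (he : Ideal.span {(p : R)} = maximalIdeal R ^ e)
    (hθ : ∀ c : Fin f → ℤ_[p], ∑ l, c l • θ l ∈ maximalIdeal R → ∀ l, (p : ℤ_[p]) ∣ c l)
    (x : Fin (e * f) → ℤ_[p]) {r : ℕ} (hr : r ≤ e) :
    monomialMap π θ e x ∈ maximalIdeal R ^ r ↔
      ∀ (k : Fin e) (l : Fin f), (k : ℕ) < r → (p : ℤ_[p]) ∣ x (finProdFinEquiv (k, l)) := by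
  have hsmul : ∀ (c : ℤ_[p]) (y : R), (p : ℤ_[p]) ∣ c → c • y ∈ maximalIdeal R ^ e := by
    rintro _ y ⟨c, rfl⟩
    rw [mul_smul, Algebra.smul_def, map_natCast, ← he]
    exact Ideal.mul_mem_right _ _ (Ideal.mem_span_singleton_self _)
  have hpow : ∀ k : ℕ, π ^ k ∈ maximalIdeal R ^ k := fun k => by
    simpa using (pow_mul_mem_pow_iff (k := k) (r := 0) (x := 1) hπ)
  -- the terms outside level `j` do not matter modulo the power `j + 1`
  have hterm : ∀ (j : ℕ) (hj : j < e),
      (∀ (k : Fin e) (l : Fin f), (k : ℕ) < j → (p : ℤ_[p]) ∣ x (finProdFinEquiv (k, l))) →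
      ((monomialMap π θ e x ∈ maximalIdeal R ^ (j + 1)) ↔
        ∑ l : Fin f, x (finProdFinEquiv (⟨j, hj⟩, l)) • θ l ∈ maximalIdeal R) := by
    intro j hj hx
    rw [monomialMap_apply, ← Finset.add_sum_erase _ _ (mem_univ (⟨j, hj⟩ : Fin e)),
      Ideal.add_mem_iff_left, pow_mul_mem_pow_iff hπ, pow_one]
    refine Ideal.sum_mem _ fun k hk => ?_
    have hkj : (k : ℕ) ≠ j := fun h => Finset.ne_of_mem_erase hk (Fin.ext h)
    rcases lt_or_gt_of_ne hkj with h | h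
    · exact Ideal.mul_mem_left _ _ (Ideal.sum_mem _ fun l _ =>
        Ideal.pow_le_pow_right hj (hsmul _ _ (hx k l h)))
    · exact Ideal.mul_mem_right _ _ (Ideal.pow_le_pow_right h (hpow k))
  induction r with
  | zero => simp
  | succ j ih =>
    have hje : j < e := hr
    have ih' := ih hje.le
    constructor
    · intro h
      have h1 := ih'.1 (Ideal.pow_le_pow_right (Nat.le_succ j) h)
      have h2 := hθ _ ((hterm j hje h1).1 h)
      intro k l hk
      rcases (Nat.lt_succ_iff.1 hk).lt_or_eq with hk | hk
      · exact h1 k l hk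
      · have : k = ⟨j, hje⟩ := Fin.ext hk
        rw [this]; exact h2 l
    · intro h
      refine (hterm j hje fun k l hk => h k l (hk.trans (Nat.lt_succ_self j))).2 ?_
      refine Ideal.sum_mem _ fun l _ => ?_
      have := hsmul _ (θ l) (h ⟨j, hje⟩ l (Nat.lt_succ_self j))
      exact Ideal.pow_le_self (by omega) this

theorem mem_latticeChain_mul_iff {x : Fin (e * f) → ℤ_[p]} {r : ℕ} (hr : r ≤ e) :
    x ∈ latticeChain p (e * f) (f * r) ↔
      ∀ (k : Fin e) (l : Fin f), (k : ℕ) < r → (p : ℤ_[p]) ∣ x (finProdFinEquiv (k, l)) := by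
  have hval : ∀ (k : Fin e) (l : Fin f),
      ((finProdFinEquiv (k, l) : Fin (e * f)) : ℕ) = l + f * k := fun _ _ => rfl
  constructor
  · intro h k l hk
    have h1 := h (finProdFinEquiv (k, l)) 0 (by
      have h2 : f * (k + 1) ≤ f * r := Nat.mul_le_mul_left f hk
      rw [hval]
      have := l.2
      rw [mul_add] at h2
      omega)
    simpa using h1
  · intro h i t hit
    obtain ⟨⟨k, l⟩, rfl⟩ := finProdFinEquiv.surjective i
    rw [hval] at hit
    have h1 : f * r ≤ f * e := Nat.mul_le_mul_left f hr
    rw [mul_comm f e] at h1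
    have ht : t = 0 := by
      by_contra h0
      have : e * f * 1 ≤ e * f * t := Nat.mul_le_mul_left _ (Nat.pos_of_ne_zero h0)
      omega
    subst ht
    have hk : (k : ℕ) < r := Nat.lt_of_mul_lt_mul_left (a := f) (by omega)
    simpa using h k l hk

theorem p_smul_mem_pow_iff (hπ : maximalIdeal R = Ideal.span {π})
    (he : Ideal.span {(p : R)} = maximalIdeal R ^ e) {y : R} {K : ℕ} :
    (p : ℤ_[p]) • y ∈ maximalIdeal R ^ (e + K) ↔ y ∈ maximalIdeal R ^ K := by
  rw [hπ, Ideal.span_singleton_pow, Ideal.span_singleton_eq_span_singleton] at he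
  obtain ⟨u, hu⟩ := he
  rw [← pow_mul_mem_pow_iff (k := e) hπ (x := y), ← hu, Algebra.smul_def, map_natCast,
    mul_right_comm, Ideal.mul_unit_mem_iff_mem _ u.isUnit]

theorem exists_monomialMap_sub_mem (hπ : maximalIdeal R = Ideal.span {π})
    (hθ : ∀ x, ∃ c : Fin f → ℤ_[p], x - ∑ l, c l • θ l ∈ maximalIdeal R) (x : R) {r : ℕ}
    (hr : r ≤ e) : ∃ y : Fin (e * f) → ℤ_[p], x - monomialMap π θ e y ∈ maximalIdeal R ^ r := by
  classical
  induction r with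
  | zero => exact ⟨0, by simp⟩
  | succ r ih =>
    obtain ⟨y, hy⟩ := ih (by omega)
    rw [hπ, Ideal.span_singleton_pow, Ideal.mem_span_singleton] at hy
    obtain ⟨u, hu⟩ := hy
    obtain ⟨c, hc⟩ := hθ u
    have hre : r < e := hr
    refine ⟨y + fun i => if (finProdFinEquiv.symm i).1 = ⟨r, hre⟩ then c (finProdFinEquiv.symm i).2
      else 0, ?_⟩
    have h1 : monomialMap π θ e (fun i => if (finProdFinEquiv.symm i).1 = ⟨r, hre⟩ then
        c (finProdFinEquiv.symm i).2 else 0) = π ^ r * ∑ l, c l • θ l := by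
      rw [monomialMap_apply, Finset.sum_eq_single (⟨r, hre⟩ : Fin e)]
      · simp
      · intro k _ hk
        simp [hk]
      · simp
    rw [map_add, h1, ← sub_sub, hu, ← mul_sub, pow_mul_mem_pow_iff hπ, pow_one]
    exact hc

variable [Module.Finite ℤ_[p] R]

theorem liesOver_maximalIdeal : (maximalIdeal R).LiesOver (maximalIdeal ℤ_[p]) := by
  constructor
  have : ((maximalIdeal R).under ℤ_[p]).IsMaximal :=
    Ideal.isMaximal_comap_of_isIntegral_of_isMaximal (maximalIdeal R)
  exact (IsLocalRing.eq_maximalIdeal this).symm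

theorem natCast_p_mem_maximalIdeal : (p : R) ∈ maximalIdeal R := by
  have h := (liesOver_maximalIdeal (p := p) (R := R)).over
  have h1 : (p : ℤ_[p]) ∈ maximalIdeal ℤ_[p] := by
    rw [PadicInt.maximalIdeal_eq_span_p]; exact Ideal.mem_span_singleton_self _
  rw [h, Ideal.mem_comap, map_natCast] at h1
  exact h1

/-- Lifts `θ` to `R` of a basis of the residue field over `𝔽_p`. -/
theorem exists_residue_basis : ∃ θ : Fin ((maximalIdeal R).inertiaDeg ℤ_[p]) → R,
    (∀ x, ∃ c : Fin ((maximalIdeal R).inertiaDeg ℤ_[p]) → ℤ_[p],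
      x - ∑ l, c l • θ l ∈ maximalIdeal R) ∧
    ∀ c : Fin ((maximalIdeal R).inertiaDeg ℤ_[p]) → ℤ_[p],
      ∑ l, c l • θ l ∈ maximalIdeal R → ∀ l, (p : ℤ_[p]) ∣ c l := by
  have := liesOver_maximalIdeal (p := p) (R := R)
  have hfr := Ideal.inertiaDeg_eq_of_isMaximal (maximalIdeal ℤ_[p]) (maximalIdeal R)
  let : Field (ℤ_[p] ⧸ maximalIdeal ℤ_[p]) := Ideal.Quotient.field _
  have : Module.Finite (ℤ_[p] ⧸ maximalIdeal ℤ_[p]) (R ⧸ maximalIdeal R) :=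
    Module.Finite.of_restrictScalars_finite ℤ_[p] _ _
  let b := Module.finBasisOfFinrankEq (ℤ_[p] ⧸ maximalIdeal ℤ_[p]) (R ⧸ maximalIdeal R) hfr.symm
  choose θ hθ using fun l => Ideal.Quotient.mk_surjective (b l)
  have hmk : ∀ c : Fin ((maximalIdeal R).inertiaDeg ℤ_[p]) → ℤ_[p],
      Ideal.Quotient.mk (maximalIdeal R) (∑ l, c l • θ l) =
        ∑ l, (Ideal.Quotient.mk (maximalIdeal ℤ_[p]) (c l)) • b l := fun c => by
    rw [map_sum]
    refine Finset.sum_congr rfl fun l _ => ?_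
    rw [← hθ, Algebra.smul_def, Algebra.smul_def, map_mul]
    rfl
  refine ⟨θ, fun x => ?_, fun c hc l => ?_⟩
  · choose c hc using fun l =>
      Ideal.Quotient.mk_surjective (b.repr (Ideal.Quotient.mk (maximalIdeal R) x) l)
    refine ⟨c, ?_⟩
    rw [← Ideal.Quotient.eq, hmk]
    simp only [hc]
    exact (b.sum_repr _).symm
  · have h0 := hmk c
    rw [Ideal.Quotient.eq_zero_iff_mem.2 hc] at h0
    have h1 := Fintype.linearIndependent_iff.1 b.linearIndependent _ h0.symm l
    rwa [Ideal.Quotient.eq_zero_iff_mem, PadicInt.maximalIdeal_eq_span_p,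
      Ideal.mem_span_singleton] at h1

theorem monomialMap_mem_pow_iff (hπ : maximalIdeal R = Ideal.span {π})
    (he : Ideal.span {(p : R)} = maximalIdeal R ^ e)
    (hθ : ∀ c : Fin f → ℤ_[p], ∑ l, c l • θ l ∈ maximalIdeal R → ∀ l, (p : ℤ_[p]) ∣ c l)
    (x : Fin (e * f) → ℤ_[p]) (K : ℕ) :
    monomialMap π θ e x ∈ maximalIdeal R ^ K ↔ x ∈ latticeChain p (e * f) (f * K) := by
  induction K using Nat.strong_induction_on generalizing x with
  | _ K ih =>
    rcases le_or_gt K e with hK | hK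
    · rw [monomialMap_mem_pow_iff_of_le hπ he hθ x hK, mem_latticeChain_mul_iff hK]
    · have hdiv : ∀ x : Fin (e * f) → ℤ_[p], x ∈ latticeChain p (e * f) (f * e) →
          ∃ y, x = (p : ℤ_[p]) • y := fun x hx => by
        have := fun i => ((mem_latticeChain_mul_iff le_rfl).1 hx) (finProdFinEquiv.symm i).1
          (finProdFinEquiv.symm i).2 (Fin.is_lt _)
        simp only [Prod.mk.eta, Equiv.apply_symm_apply] at this
        choose y hy using this
        exact ⟨y, funext hy⟩
      obtain ⟨j, rfl⟩ := Nat.exists_eq_add_of_le hK.le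
      have he0 : 0 < e := by
        rcases Nat.eq_zero_or_pos e with rfl | h
        · rw [pow_zero, Ideal.one_eq_top] at he
          have h1 := natCast_p_mem_maximalIdeal (p := p) (R := R)
          rw [← Ideal.span_singleton_le_iff_mem, he, top_le_iff] at h1
          exact absurd h1 (maximalIdeal.isMaximal R).ne_top
        · exact h
      have hiff : ∀ y : Fin (e * f) → ℤ_[p],
          monomialMap π θ e ((p : ℤ_[p]) • y) ∈ maximalIdeal R ^ (e + j) ↔
            (p : ℤ_[p]) • y ∈ latticeChain p (e * f) (f * (e + j)) := fun y => by
        rw [map_smul, p_smul_mem_pow_iff hπ he, ih j (by omega),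
          show f * (e + j) = f * j + e * f by ring, p_smul_mem_latticeChain_iff]
      constructor
      · intro h
        have h1 : x ∈ latticeChain p (e * f) (f * e) := by
          rw [mem_latticeChain_mul_iff le_rfl, ← monomialMap_mem_pow_iff_of_le hπ he hθ x le_rfl]
          exact Ideal.pow_le_pow_right (Nat.le_add_right e j) h
        obtain ⟨y, rfl⟩ := hdiv x h1
        exact (hiff y).1 h
      · intro h
        obtain ⟨y, rfl⟩ := hdiv x (latticeChain_anti
          (Nat.mul_le_mul_left f (Nat.le_add_right e j)) h)
        exact (hiff y).2 h

/-- There are `ℤ_[p]`-coordinates on `R` in which the powers of the maximal ideal are every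
`f`-th member of the standard chain. -/
theorem exists_coordinates [FaithfulSMul ℤ_[p] R]
    (he : Ideal.span {(p : R)} = maximalIdeal R ^ e)
    (hf : f = (maximalIdeal R).inertiaDeg ℤ_[p]) :
    ∃ Φ : (Fin (e * f) → ℤ_[p]) ≃ₗ[ℤ_[p]] R,
      ∀ x K, Φ x ∈ maximalIdeal R ^ K ↔ x ∈ latticeChain p (e * f) (f * K) := by
  subst hf
  obtain ⟨π, hπ⟩ := IsDiscreteValuationRing.exists_irreducible R
  have hπ := hπ.maximalIdeal_eq
  obtain ⟨θ, hθ1, hθ2⟩ := exists_residue_basis (p := p) (R := R)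
  have hmem := monomialMap_mem_pow_iff hπ he hθ2
  refine ⟨LinearEquiv.ofBijective (monomialMap π θ e) ⟨?_, ?_⟩, hmem⟩
  · rw [← LinearMap.ker_eq_bot, LinearMap.ker_eq_bot']
    intro x hx
    by_contra h0
    obtain ⟨i, t, hl⟩ := exists_isLead h0
    have hpos : 0 < (maximalIdeal R).inertiaDeg ℤ_[p] := Ideal.inertiaDeg_pos _ _
    refine hl.2 (latticeChain_anti (Nat.le_mul_of_pos_left _ hpos) ((hmem x _).1 ?_))
    rw [hx]
    exact zero_mem _
  · rw [← LinearMap.range_eq_top, ← top_le_iff]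
    refine Submodule.le_of_le_smul_of_le_jacobson_bot (I := Ideal.span {(p : ℤ_[p])})
      Module.Finite.fg_top ?_ ?_
    · rw [← PadicInt.maximalIdeal_eq_span_p]
      exact IsLocalRing.maximalIdeal_le_jacobson _
    · intro x _
      obtain ⟨y, hy⟩ := exists_monomialMap_sub_mem hπ hθ1 x (le_refl e)
      rw [← sub_add_cancel x (monomialMap π θ e y), add_comm]
      refine Submodule.add_mem_sup ⟨y, rfl⟩ ?_
      rw [← he, Ideal.mem_span_singleton] at hy
      obtain ⟨u, hu⟩ := hy
      rw [hu]
      have : (p : R) * u = (p : ℤ_[p]) • u := by rw [Algebra.smul_def, map_natCast]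
      rw [this]
      exact Submodule.smul_mem_smul (Ideal.mem_span_singleton_self _) Submodule.mem_top

end Coordinates

/-! ### Lattices in a direct sum -/

section Graph

variable {p : ℕ} [hp : Fact p.Prime] {V P Q : Type*} [AddCommGroup V] [Module ℤ_[p] V]
  [AddCommGroup P] [Module ℤ_[p] P] [AddCommGroup Q] [Module ℤ_[p] Q]

/-- The submodule of `P × Q` with intersection `L` with `Q`, with projection `θ Λ` to `P`, and with
gluing map `φ`. -/
def graphSubmodule (θ : V →ₗ[ℤ_[p]] P) (L : Submodule ℤ_[p] Q) (Λ : Submodule ℤ_[p] V)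
    (φ : Λ →ₗ[ℤ_[p]] Q ⧸ L) : Submodule ℤ_[p] (P × Q) where
  carrier := {w | ∃ v : Λ, θ v = w.1 ∧ φ v = L.mkQ w.2}
  add_mem' := by
    rintro w w' ⟨v, h1, h2⟩ ⟨v', h1', h2'⟩
    exact ⟨v + v', by simp [h1, h1'], by simp [h2, h2']⟩
  zero_mem' := ⟨0, by simp, by simp⟩
  smul_mem' := by
    rintro c w ⟨v, h1, h2⟩
    exact ⟨c • v, by simp [h1], by simp [h2]⟩

theorem mem_graphSubmodule {θ : V →ₗ[ℤ_[p]] P} {L : Submodule ℤ_[p] Q} {Λ : Submodule ℤ_[p] V}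
    {φ : Λ →ₗ[ℤ_[p]] Q ⧸ L} {w : P × Q} :
    w ∈ graphSubmodule θ L Λ φ ↔ ∃ v : Λ, θ v = w.1 ∧ φ v = L.mkQ w.2 := Iff.rfl

theorem zero_mk_mem_graphSubmodule {θ : V →ₗ[ℤ_[p]] P} (hθ : Function.Injective θ)
    {L : Submodule ℤ_[p] Q} {Λ : Submodule ℤ_[p] V} {φ : Λ →ₗ[ℤ_[p]] Q ⧸ L} {x : Q} :
    ((0, x) : P × Q) ∈ graphSubmodule θ L Λ φ ↔ x ∈ L := by
  rw [mem_graphSubmodule]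
  constructor
  · rintro ⟨v, h1, h2⟩
    have hv : v = 0 := Subtype.ext (hθ (by simpa using h1))
    rw [hv, map_zero] at h2
    exact (Submodule.Quotient.mk_eq_zero L).1 h2.symm
  · intro hx
    exact ⟨0, by simp, by rw [map_zero]; exact ((Submodule.Quotient.mk_eq_zero L).2 hx).symm⟩

/-- The index is the index `[Q : L]` of the intersection with `Q` times the index of the projection
`θ Λ` in `P`. -/
theorem card_quotient_graphSubmodule {θ : V →ₗ[ℤ_[p]] P} (hθ : Function.Injective θ)
    (L : Submodule ℤ_[p] Q) (Λ : Submodule ℤ_[p] V) (φ : Λ →ₗ[ℤ_[p]] Q ⧸ L) :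
    Nat.card ((P × Q) ⧸ graphSubmodule θ L Λ φ) =
      Nat.card (Q ⧸ L) * (Nat.card (V ⧸ Λ) * Nat.card (P ⧸ LinearMap.range θ)) := by
  set N := (graphSubmodule θ L Λ φ).toAddSubgroup with hN
  set T := Λ.toAddSubgroup.map θ.toAddMonoidHom with hT
  set K := T.comap (AddMonoidHom.fst P Q) with hK
  have hmem : ∀ w, w ∈ N ↔ ∃ v : Λ, θ v = w.1 ∧ φ v = L.mkQ w.2 := fun w => Iff.rfl
  have hsup : K = (AddMonoidHom.inr P Q).range ⊔ N := by
    apply le_antisymm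
    · rintro w ⟨v, hv, hvw⟩
      obtain ⟨y, hy⟩ := L.mkQ_surjective (φ ⟨v, hv⟩)
      have hw : w = (0, w.2 - y) + (w.1, y) := by ext <;> simp
      rw [hw]
      exact add_mem (AddSubgroup.mem_sup_left ⟨_, rfl⟩)
        (AddSubgroup.mem_sup_right ((hmem _).2 ⟨⟨v, hv⟩, hvw, hy.symm⟩))
    · refine sup_le ?_ ?_
      · rintro _ ⟨y, rfl⟩
        exact ⟨0, Λ.zero_mem, by simp⟩
      · intro w hw
        obtain ⟨v, h1, -⟩ := (hmem w).1 hw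
        exact ⟨v, v.2, h1⟩
  have h1 : N.relIndex K = L.toAddSubgroup.index := by
    rw [hsup, AddSubgroup.relIndex_sup_right, ← AddSubgroup.index_comap]
    congr 1
    ext x
    exact zero_mk_mem_graphSubmodule hθ
  have h2 : K.index = Λ.toAddSubgroup.index * (LinearMap.range θ).toAddSubgroup.index := by
    rw [hK, AddSubgroup.index_comap_of_surjective _ Prod.fst_surjective, hT,
      AddSubgroup.index_map_of_injective _ hθ]
    rfl
  have h3 : N ≤ K := hsup ▸ le_sup_right
  have h4 := AddSubgroup.relIndex_mul_index h3
  rw [h1, h2] at h4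
  exact h4.symm

/-- Every additive subgroup that contains `p ^ k M` is a `ℤ_[p]`-submodule. -/
theorem smul_mem_of_pow_smul_mem {M : Type*} [AddCommGroup M] [Module ℤ_[p] M]
    (A : AddSubgroup M) {k : ℕ} (hk : ∀ x : M, (p : ℤ_[p]) ^ k • x ∈ A) (c : ℤ_[p]) {x : M}
    (hx : x ∈ A) : c • x ∈ A := by
  obtain ⟨d, hd⟩ := Ideal.mem_span_singleton.1 (PadicInt.appr_spec k c)
  have h1 : c • x = c.appr k • x + (p : ℤ_[p]) ^ k • d • x := by
    rw [← mul_smul, ← hd, sub_smul, Nat.cast_smul_eq_nsmul]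
    abel
  rw [h1]
  exact add_mem (A.nsmul_mem hx _) (hk _)

/-- A lattice in `ℤ_[p]ⁿ` is free of rank `n`, so a homomorphism on it is given by `n` values. -/
theorem natCard_linearMap_of_lattice {n : ℕ} (Λ : Lattices p (Fin n → ℤ_[p])) (M : Type*)
    [AddCommGroup M] [Module ℤ_[p] M] : Nat.card (Λ.1 →ₗ[ℤ_[p]] M) = Nat.card M ^ n := by
  obtain ⟨Λ, k, hk⟩ := Λ
  have hp0 : (p : ℤ_[p]) ^ k ≠ 0 := pow_ne_zero _ PadicInt.prime_p.ne_zero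
  have hfr : Module.finrank ℤ_[p] Λ = n := by
    refine le_antisymm ?_ ?_
    · simpa using Submodule.finrank_le Λ
    · have := LinearMap.finrank_le_finrank_of_injective
        (f := (LinearMap.lsmul ℤ_[p] (Fin n → ℤ_[p]) ((p : ℤ_[p]) ^ k)).codRestrict Λ hk)
        (fun x y h => smul_right_injective _ hp0 (congrArg Subtype.val h))
      simpa using this
  have b := Module.finBasisOfFinrankEq ℤ_[p] Λ hfr
  rw [← Nat.card_congr (b.constr ℤ_[p] (M' := M)).toEquiv, Nat.card_fun]
  simp

end Graph

/-! ### Lattices that come from normal subgroups of the Heisenberg group -/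

section HeisenbergLattices

open IsLocalRing

variable {p : ℕ} [hp : Fact p.Prime] {R : Type*} [CommRing R] [IsDomain R]
  [IsDiscreteValuationRing R] [Algebra ℤ_[p] R] {e n : ℕ}

theorem pow_smul_mem_of_mem_pow (he : Ideal.span {(p : R)} = maximalIdeal R ^ e) {k : ℕ} {x : R}
    (hx : x ∈ maximalIdeal R ^ (e * k)) : ∃ y, x = (p : ℤ_[p]) ^ k • y := by
  rw [pow_mul, ← he, Ideal.span_singleton_pow, Ideal.mem_span_singleton] at hx
  obtain ⟨y, rfl⟩ := hx
  exact ⟨y, by rw [Algebra.smul_def, map_pow, map_natCast]⟩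

theorem pow_smul_mem_pow_mul (he : Ideal.span {(p : R)} = maximalIdeal R ^ e) (k : ℕ) (y : R) :
    (p : ℤ_[p]) ^ k • y ∈ maximalIdeal R ^ (e * k) := by
  rw [pow_mul, ← he, Ideal.span_singleton_pow, Ideal.mem_span_singleton]
  exact ⟨y, by rw [Algebra.smul_def, map_pow, map_natCast]⟩

/-- The exponent of the largest power of the maximal ideal contained in `L`, for a lattice `L` in
`R`. It is `0` if `L` contains no power of the maximal ideal. -/
noncomputable def conductorExponent (L : Submodule ℤ_[p] R) : ℕ :=
  sInf {c | ∀ x ∈ maximalIdeal R ^ c, x ∈ L}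

theorem forall_mem_pow_iff (he : Ideal.span {(p : R)} = maximalIdeal R ^ e)
    (L : Lattices p R) {c : ℕ} :
    (∀ x ∈ maximalIdeal R ^ c, x ∈ L.1) ↔ conductorExponent L.1 ≤ c := by
  refine ⟨fun h => Nat.sInf_le h, fun h x hx => ?_⟩
  have hne : {c | ∀ x ∈ maximalIdeal R ^ c, x ∈ L.1}.Nonempty := by
    obtain ⟨k, hk⟩ := L.2
    refine ⟨e * k, fun x hx => ?_⟩
    obtain ⟨y, rfl⟩ := pow_smul_mem_of_mem_pow he hx
    exact hk y
  exact Nat.sInf_mem hne x (Ideal.pow_le_pow_right h hx)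

/-- An element all of whose multiples lie in `L` lies in the largest power of the maximal ideal
contained in `L`. -/
theorem mem_pow_conductorExponent {L : Submodule ℤ_[p] R} {a : R} (h : ∀ r : R, r * a ∈ L) :
    a ∈ maximalIdeal R ^ conductorExponent L := by
  by_cases ha : a = 0
  · rw [ha]; exact zero_mem _
  obtain ⟨π, hπ⟩ := IsDiscreteValuationRing.exists_irreducible R
  obtain ⟨j, u, hu⟩ := IsDiscreteValuationRing.eq_unit_mul_pow_irreducible ha hπ
  have hspan : maximalIdeal R ^ j = Ideal.span {π ^ j} := by
    rw [hπ.maximalIdeal_eq, Ideal.span_singleton_pow]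
  have h1 : conductorExponent L ≤ j := Nat.sInf_le fun x hx => by
    rw [hspan, Ideal.mem_span_singleton] at hx
    obtain ⟨y, rfl⟩ := hx
    have : π ^ j * y = (y * ↑u⁻¹) * a := by
      rw [hu, mul_assoc, Units.inv_mul_cancel_left, mul_comm]
    rw [this]
    exact h _
  refine Ideal.pow_le_pow_right h1 ?_
  rw [hspan, Ideal.mem_span_singleton, hu]
  exact Dvd.intro_left _ rfl

/-- The lattices in `(R × R) × R` that correspond to open normal subgroups of the Heisenberg group:
those that contain the ideal generated by their first two coordinates in the last coordinate. -/
def HeisenbergLattices (p : ℕ) [Fact p.Prime] (R : Type*) [CommRing R] [Algebra ℤ_[p] R] : Type _ :=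
  {N : Lattices p ((R × R) × R) //
    ∀ w ∈ N.1, ∀ r : R, ((0, r * w.1.1) : (R × R) × R) ∈ N.1 ∧
      ((0, r * w.1.2) : (R × R) × R) ∈ N.1}

/-- The data classifying the Heisenberg lattices: the intersection with the centre, the image in
`R × R` in suitable coordinates, and the gluing map. -/
abbrev GluingData (p : ℕ) [Fact p.Prime] (R : Type*) [CommRing R] [Algebra ℤ_[p] R] (n : ℕ) :
    Type _ :=
  Σ x : Lattices p R × Lattices p (Fin n → ℤ_[p]), (x.2.1 →ₗ[ℤ_[p]] R ⧸ x.1.1)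

variable {θ : ℕ → (Fin n → ℤ_[p]) →ₗ[ℤ_[p]] R × R}

theorem exists_pow_smul_mem_graphSubmodule (he : Ideal.span {(p : R)} = maximalIdeal R ^ e)
    (he0 : e ≠ 0)
    (hrange : ∀ c u, (∃ v, θ c v = u) ↔ u.1 ∈ maximalIdeal R ^ c ∧ u.2 ∈ maximalIdeal R ^ c)
    (c : ℕ) (L : Lattices p R) (Λ : Lattices p (Fin n → ℤ_[p]))
    (φ : Λ.1 →ₗ[ℤ_[p]] R ⧸ L.1) :
    ∃ k, ∀ x, (p : ℤ_[p]) ^ k • x ∈ graphSubmodule (θ c) L.1 Λ.1 φ := by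
  obtain ⟨L, i, hi⟩ := L
  obtain ⟨Λ, j, hj⟩ := Λ
  refine ⟨i + (j + c), fun x => ?_⟩
  have hle : ∀ y : R, (p : ℤ_[p]) ^ c • y ∈ maximalIdeal R ^ c := fun y =>
    Ideal.pow_le_pow_right (Nat.le_mul_of_pos_left c (Nat.pos_of_ne_zero he0))
      (pow_smul_mem_pow_mul he c y)
  obtain ⟨v, hv⟩ := (hrange c ((p : ℤ_[p]) ^ c • x.1)).2 ⟨hle _, hle _⟩
  refine ⟨(p : ℤ_[p]) ^ i • ⟨(p : ℤ_[p]) ^ j • v, hj v⟩, ?_, ?_⟩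
  · simp only [Submodule.coe_smul, map_smul, hv, Prod.smul_fst, pow_add, mul_smul]
  · have hzero : ∀ y : R ⧸ L, (p : ℤ_[p]) ^ i • y = 0 := fun y => by
      obtain ⟨y, rfl⟩ := L.mkQ_surjective y
      rw [← map_smul]
      exact (Submodule.Quotient.mk_eq_zero L).2 (hi y)
    rw [map_smul, hzero, Prod.smul_snd, pow_add, mul_smul, map_smul, hzero]

/-- Heisenberg lattices correspond to triples of a lattice `L` in `R`, a lattice in the square of
the largest ideal contained in `L`, and a homomorphism from the latter lattice to `R ⧸ L`. -/
theorem exists_gluingEquiv (he : Ideal.span {(p : R)} = maximalIdeal R ^ e) (he0 : e ≠ 0)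
    (hinj : ∀ c, Function.Injective (θ c))
    (hrange : ∀ c u, (∃ v, θ c v = u) ↔ u.1 ∈ maximalIdeal R ^ c ∧ u.2 ∈ maximalIdeal R ^ c) :
    ∃ E : GluingData p R n ≃ HeisenbergLattices p R, ∀ x, (E x).1.1 =
      graphSubmodule (θ (conductorExponent x.1.1.1)) x.1.1.1 x.1.2.1 x.2 := by
  refine ⟨Equiv.ofBijective (fun x => ⟨⟨graphSubmodule (θ (conductorExponent x.1.1.1)) x.1.1.1
    x.1.2.1 x.2, exists_pow_smul_mem_graphSubmodule he he0 hrange _ _ _ _⟩, ?_⟩) ⟨?_, ?_⟩,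
    fun x => rfl⟩
  · rintro w ⟨v, hv, -⟩ r
    have hw := (hrange (conductorExponent x.1.1.1) w.1).1 ⟨v, hv⟩
    have hL := (forall_mem_pow_iff he x.1.1).2 le_rfl
    rw [zero_mk_mem_graphSubmodule (hinj _), zero_mk_mem_graphSubmodule (hinj _)]
    exact ⟨hL _ (Ideal.mul_mem_left _ _ hw.1), hL _ (Ideal.mul_mem_left _ _ hw.2)⟩
  · rintro ⟨⟨L, Λ⟩, φ⟩ ⟨⟨L', Λ'⟩, φ'⟩ h
    have hN : graphSubmodule (θ (conductorExponent L.1)) L.1 Λ.1 φ =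
      graphSubmodule (θ (conductorExponent L'.1)) L'.1 Λ'.1 φ' :=
      congrArg (fun N : HeisenbergLattices p R => N.1.1) h
    have hL : L = L' := Subtype.ext <| by
      ext x
      rw [← zero_mk_mem_graphSubmodule (hinj (conductorExponent L.1)) (φ := φ), hN,
        zero_mk_mem_graphSubmodule (hinj _)]
    subst hL
    have hfst : ∀ (Λ : Lattices p (Fin n → ℤ_[p])) (φ : Λ.1 →ₗ[ℤ_[p]] R ⧸ L.1) (v : Fin n → ℤ_[p])
        (x : R), (θ (conductorExponent L.1) v, x) ∈
          graphSubmodule (θ (conductorExponent L.1)) L.1 Λ.1 φ ↔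
            ∃ hv : v ∈ Λ.1, φ ⟨v, hv⟩ = L.1.mkQ x := by
      intro Λ φ v x
      rw [mem_graphSubmodule]
      constructor
      · rintro ⟨⟨v', hv'⟩, h1, h2⟩
        have : v' = v := hinj _ h1
        subst this
        exact ⟨hv', h2⟩
      · rintro ⟨hv, h2⟩
        exact ⟨⟨v, hv⟩, rfl, h2⟩
    have hΛ : Λ = Λ' := Subtype.ext <| by
      ext v
      constructor
      · intro hv
        obtain ⟨x, hx⟩ := L.1.mkQ_surjective (φ ⟨v, hv⟩)
        have h1 := (hfst Λ φ v x).2 ⟨hv, hx.symm⟩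
        rw [hN] at h1
        exact ((hfst Λ' φ' v x).1 h1).1
      · intro hv
        obtain ⟨x, hx⟩ := L.1.mkQ_surjective (φ' ⟨v, hv⟩)
        have h1 := (hfst Λ' φ' v x).2 ⟨hv, hx.symm⟩
        rw [← hN] at h1
        exact ((hfst Λ φ v x).1 h1).1
    subst hΛ
    have hφ : φ = φ' := by
      ext ⟨v, hv⟩
      obtain ⟨x, hx⟩ := L.1.mkQ_surjective (φ ⟨v, hv⟩)
      have h1 := (hfst Λ φ v x).2 ⟨hv, hx.symm⟩
      rw [hN] at h1
      rw [← hx, ((hfst Λ φ' v x).1 h1).2]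
    rw [hφ]
  · rintro ⟨⟨N, k, hk⟩, hN⟩
    set L : Submodule ℤ_[p] R := N.comap (LinearMap.inr ℤ_[p] (R × R) R) with hLdef
    have hmemL : ∀ x, x ∈ L ↔ ((0, x) : (R × R) × R) ∈ N := fun x => Iff.rfl
    set Λ : Submodule ℤ_[p] (Fin n → ℤ_[p]) := (N.map (LinearMap.fst ℤ_[p] (R × R) R)).comap
      (θ (conductorExponent L)) with hΛdef
    have hmemΛ : ∀ v, v ∈ Λ ↔ ∃ x, (θ (conductorExponent L) v, x) ∈ N := fun v => by
      rw [hΛdef, Submodule.mem_comap, Submodule.mem_map]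
      constructor
      · rintro ⟨⟨u, x⟩, hu, rfl⟩
        exact ⟨x, hu⟩
      · rintro ⟨x, hx⟩
        exact ⟨_, hx, rfl⟩
    have hL : ∃ k : ℕ, ∀ x : R, (p : ℤ_[p]) ^ k • x ∈ L := ⟨k, fun x => by
      have := hk (0, x)
      rwa [Prod.smul_mk, smul_zero] at this⟩
    have hΛ : ∃ k : ℕ, ∀ v, (p : ℤ_[p]) ^ k • v ∈ Λ := ⟨k, fun v => by
      rw [hmemΛ]
      refine ⟨0, ?_⟩
      have := hk (θ (conductorExponent L) v, 0)
      rwa [Prod.smul_mk, smul_zero, ← map_smul] at this⟩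
    choose x hx using fun v : Λ => (hmemΛ v).1 v.2
    have hmk : ∀ y y' : R, (∃ u, (u, y) ∈ N ∧ (u, y') ∈ N) → L.mkQ y = L.mkQ y' := by
      rintro y y' ⟨u, h1, h2⟩
      refine (Submodule.Quotient.eq L).2 ((hmemL _).2 ?_)
      simpa using sub_mem h1 h2
    let φ : Λ →ₗ[ℤ_[p]] R ⧸ L :=
      { toFun := fun v => L.mkQ (x v)
        map_add' := fun v w => by
          rw [← map_add]
          refine hmk _ _ ⟨_, hx (v + w), ?_⟩
          simpa using add_mem (hx v) (hx w)
        map_smul' := fun c v => by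
          rw [RingHom.id_apply, ← map_smul]
          refine hmk _ _ ⟨_, hx (c • v), ?_⟩
          simpa using N.smul_mem c (hx v) }
    refine ⟨⟨(⟨L, hL⟩, ⟨Λ, hΛ⟩), φ⟩, Subtype.ext (Subtype.ext ?_)⟩
    ext ⟨u, y⟩
    constructor
    · rintro ⟨v, hv, hvy⟩
      have h1 : ((0, x v - y) : (R × R) × R) ∈ N := (Submodule.Quotient.eq L).1 hvy
      have h2 := sub_mem (hx v) h1
      rw [show θ (conductorExponent L) v = u from hv] at h2
      simpa using h2
    · intro huy
      have hu : ∃ v, θ (conductorExponent L) v = u := (hrange _ u).2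
        ⟨mem_pow_conductorExponent fun r => (hN _ huy r).1,
          mem_pow_conductorExponent fun r => (hN _ huy r).2⟩
      obtain ⟨v, rfl⟩ := hu
      exact ⟨⟨v, (hmemΛ v).2 ⟨y, huy⟩⟩, rfl, hmk _ _ ⟨_, hx _, huy⟩⟩

end HeisenbergLattices

/-! ### Open normal subgroups of the Heisenberg group -/

section Heisenberg

open IsLocalRing

section Algebra

variable {R : Type*} [CommRing R]

/-- The unitriangular matrix with entries `a`, `b` next to the diagonal and `c` in the corner. -/
def heisenbergMk (a b c : R) : heisenbergGroup R :=
  ⟨⟨!![1, a, c; 0, 1, b; 0, 0, 1], by simp [Matrix.det_fin_three]⟩, by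
    refine ⟨fun i => ?_, fun i j hij => ?_⟩
    · fin_cases i <;> simp
    · fin_cases i <;> fin_cases j <;> simp_all⟩

/-- The entries above the diagonal as coordinates of the Heisenberg group. -/
def heisenbergEquiv (R : Type*) [CommRing R] : heisenbergGroup R ≃ (R × R) × R where
  toFun h := ((h.1.1 0 1, h.1.1 1 2), h.1.1 0 2)
  invFun w := heisenbergMk w.1.1 w.1.2 w.2
  left_inv h := by
    obtain ⟨M, h1, h2⟩ := h
    refine Subtype.ext (Subtype.ext ?_)
    ext i j
    fin_cases i <;> fin_cases j <;> simp [heisenbergMk, h1, h2]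
  right_inv w := by simp [heisenbergMk]

theorem heisenbergMk_mul (a b c a' b' c' : R) : heisenbergMk a b c * heisenbergMk a' b' c' =
    heisenbergMk (a + a') (b + b') (c + c' + a * b') := by
  refine Subtype.ext (Subtype.ext ?_)
  change !![1, a, c; 0, 1, b; 0, 0, 1] * !![1, a', c'; 0, 1, b'; 0, 0, 1] =
    !![1, a + a', c + c' + a * b'; 0, 1, b + b'; 0, 0, 1]
  ext i j
  fin_cases i <;> fin_cases j <;> simp [Matrix.mul_apply, Fin.sum_univ_three] <;> ring

theorem heisenbergMk_zero : heisenbergMk (0 : R) 0 0 = 1 := by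
  refine Subtype.ext (Subtype.ext ?_)
  ext i j
  fin_cases i <;> fin_cases j <;> simp [heisenbergMk]

theorem heisenbergMk_inv (a b c : R) :
    (heisenbergMk a b c)⁻¹ = heisenbergMk (-a) (-b) (-c + a * b) := by
  rw [inv_eq_iff_mul_eq_one, heisenbergMk_mul, ← heisenbergMk_zero]
  congr 1 <;> ring

theorem heisenbergMk_conj (x y z a b c : R) :
    heisenbergMk x y z * heisenbergMk a b c * (heisenbergMk x y z)⁻¹ =
      heisenbergMk a b (c + (x * b - y * a)) := by
  rw [heisenbergMk_inv, heisenbergMk_mul, heisenbergMk_mul]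
  congr 1 <;> ring

theorem heisenbergMk_surjective (h : heisenbergGroup R) : ∃ a b c, heisenbergMk a b c = h :=
  ⟨_, _, _, (heisenbergEquiv R).left_inv h⟩

/-- The commutators with a normal subgroup: the central elements with entry a multiple of the first
two coordinates. -/
theorem central_mem_of_normal {N : Subgroup (heisenbergGroup R)} (hN : N.Normal) {a b c : R}
    (h : heisenbergMk a b c ∈ N) (x y : R) : heisenbergMk 0 0 (x * b - y * a) ∈ N := by
  have h1 := hN.conj_mem _ h (heisenbergMk x y 0)
  rw [heisenbergMk_conj] at h1
  have h2 := N.mul_mem h1 (N.inv_mem h)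
  rw [heisenbergMk_inv, heisenbergMk_mul] at h2
  convert! h2 using 2 <;> ring

/-- In the coordinates of the Heisenberg group a normal subgroup is closed under addition, because
the cocycle `a * b'` takes values in the subgroup. -/
def additiveSubgroupOfNormal (N : Subgroup (heisenbergGroup R)) (hN : N.Normal) :
    AddSubgroup ((R × R) × R) where
  carrier := {w | heisenbergMk w.1.1 w.1.2 w.2 ∈ N}
  add_mem' := by
    rintro ⟨⟨a, b⟩, c⟩ ⟨⟨a', b'⟩, c'⟩ h h'
    have h1 := N.mul_mem (N.mul_mem h h') (central_mem_of_normal hN h 0 b')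
    rw [heisenbergMk_mul, heisenbergMk_mul] at h1
    change heisenbergMk (a + a') (b + b') (c + c') ∈ N
    convert! h1 using 2 <;> simp [mul_comm]
  zero_mem' := by
    change heisenbergMk (0 : R) 0 0 ∈ N
    rw [heisenbergMk_zero]
    exact N.one_mem
  neg_mem' := by
    rintro ⟨⟨a, b⟩, c⟩ h
    have h1 := N.mul_mem (N.inv_mem h) (central_mem_of_normal hN h 0 b)
    rw [heisenbergMk_inv, heisenbergMk_mul] at h1
    change heisenbergMk (-a) (-b) (-c) ∈ N
    convert! h1 using 2 <;> simp [mul_comm]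

/-- The normal subgroup of the Heisenberg group given in coordinates by an additive subgroup that
contains the ideal generated by its first two coordinates in the last coordinate. -/
def subgroupOfAdditive (A : AddSubgroup ((R × R) × R))
    (hA : ∀ w ∈ A, ∀ r : R, ((0, r * w.1.1) : (R × R) × R) ∈ A ∧
      ((0, r * w.1.2) : (R × R) × R) ∈ A) : Subgroup (heisenbergGroup R) where
  carrier := {h | heisenbergEquiv R h ∈ A}
  mul_mem' := by
    intro g h hg hh
    obtain ⟨a, b, c, rfl⟩ := heisenbergMk_surjective g
    obtain ⟨a', b', c', rfl⟩ := heisenbergMk_surjective h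
    change heisenbergEquiv R _ ∈ A
    rw [heisenbergMk_mul]
    convert! A.add_mem (A.add_mem hg hh) (hA _ hg b').1 using 1
    simp [heisenbergEquiv, heisenbergMk, mul_comm]
  one_mem' := by
    change heisenbergEquiv R _ ∈ A
    rw [← heisenbergMk_zero]
    exact A.zero_mem
  inv_mem' := by
    intro g hg
    obtain ⟨a, b, c, rfl⟩ := heisenbergMk_surjective g
    change heisenbergEquiv R _ ∈ A
    rw [heisenbergMk_inv]
    convert! A.add_mem (A.neg_mem hg) (hA _ hg b).1 using 1
    simp [heisenbergEquiv, heisenbergMk, mul_comm]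

theorem heisenbergMk_mem_subgroupOfAdditive {A : AddSubgroup ((R × R) × R)}
    {hA : ∀ w ∈ A, ∀ r : R, ((0, r * w.1.1) : (R × R) × R) ∈ A ∧
      ((0, r * w.1.2) : (R × R) × R) ∈ A} {a b c : R} :
    heisenbergMk a b c ∈ subgroupOfAdditive A hA ↔ ((a, b), c) ∈ A := Iff.rfl

theorem normal_subgroupOfAdditive {A : AddSubgroup ((R × R) × R)}
    (hA : ∀ w ∈ A, ∀ r : R, ((0, r * w.1.1) : (R × R) × R) ∈ A ∧
      ((0, r * w.1.2) : (R × R) × R) ∈ A) : (subgroupOfAdditive A hA).Normal := by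
  constructor
  intro h hh g
  obtain ⟨a, b, c, rfl⟩ := heisenbergMk_surjective h
  obtain ⟨x, y, z, rfl⟩ := heisenbergMk_surjective g
  rw [heisenbergMk_conj, heisenbergMk_mem_subgroupOfAdditive]
  rw [heisenbergMk_mem_subgroupOfAdditive] at hh
  have := A.add_mem hh (A.sub_mem (hA _ hh x).2 (hA _ hh y).1)
  simpa using this

/-- The group law and the addition have the same cosets of a normal subgroup. -/
theorem index_subgroupOfAdditive {A : AddSubgroup ((R × R) × R)}
    (hA : ∀ w ∈ A, ∀ r : R, ((0, r * w.1.1) : (R × R) × R) ∈ A ∧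
      ((0, r * w.1.2) : (R × R) × R) ∈ A) : (subgroupOfAdditive A hA).index = A.index := by
  refine Nat.card_congr (Quotient.congr (heisenbergEquiv R) fun g h => ?_)
  rw [QuotientGroup.leftRel_apply, QuotientAddGroup.leftRel_apply]
  obtain ⟨a, b, c, rfl⟩ := heisenbergMk_surjective g
  obtain ⟨a', b', c', rfl⟩ := heisenbergMk_surjective h
  rw [heisenbergMk_inv, heisenbergMk_mul, heisenbergMk_mem_subgroupOfAdditive]
  change _ ↔ ((-a + a', -b + b'), -c + c') ∈ A
  constructor
  · intro h
    have := A.add_mem h (hA _ h a).2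
    convert! this using 1
    ext <;> simp
    ring
  · intro h
    have := A.sub_mem h (hA _ h a).2
    convert! this using 1
    ext <;> simp
    ring

end Algebra

variable {p : ℕ} [hp : Fact p.Prime] {R : Type*} [CommRing R] [TopologicalSpace R]

theorem isOpen_of_isAdic {I : Ideal R} (hR : IsAdic I) (k : ℕ) :
    IsOpen ((I ^ k : Ideal R) : Set R) := by
  have : IsTopologicalRing R := by rw [hR]; infer_instance
  exact (isAdic_iff.1 hR).1 k

theorem continuous_heisenbergMk :
    Continuous fun w : (R × R) × R => heisenbergMk w.1.1 w.1.2 w.2 := by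
  refine Continuous.subtype_mk (Continuous.subtype_mk ?_ _) _
  refine continuous_matrix fun i j => ?_
  fin_cases i <;> fin_cases j <;> simp <;> fun_prop

theorem exists_forall_mem_of_isOpen {I : Ideal R} (hR : IsAdic I)
    {N : Subgroup (heisenbergGroup R)} (hN : IsOpen (N : Set (heisenbergGroup R))) :
    ∃ k, ∀ a ∈ I ^ k, ∀ b ∈ I ^ k, ∀ c ∈ I ^ k, heisenbergMk a b c ∈ N := by
  have : IsTopologicalRing R := by rw [hR]; infer_instance
  have h1 : (fun w : (R × R) × R => heisenbergMk w.1.1 w.1.2 w.2) ⁻¹' N ∈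
      nhds (((0, 0), 0) : (R × R) × R) :=
    (hN.preimage continuous_heisenbergMk).mem_nhds (by
      change heisenbergMk (0 : R) 0 0 ∈ N
      rw [heisenbergMk_zero]; exact N.one_mem)
  rw [nhds_prod_eq, Filter.mem_prod_iff] at h1
  obtain ⟨s, hs, t, ht, hst⟩ := h1
  rw [nhds_prod_eq, Filter.mem_prod_iff] at hs
  obtain ⟨s1, hs1, s2, hs2, hss⟩ := hs
  obtain ⟨k1, h1⟩ := (isAdic_iff.1 hR).2 s1 hs1
  obtain ⟨k2, h2⟩ := (isAdic_iff.1 hR).2 s2 hs2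
  obtain ⟨k3, h3⟩ := (isAdic_iff.1 hR).2 t ht
  refine ⟨k1 + k2 + k3, fun a ha b hb c hc => ?_⟩
  have h := @hst ((a, b), c) ⟨hss ⟨h1 (Ideal.pow_le_pow_right (by omega) ha),
    h2 (Ideal.pow_le_pow_right (by omega) hb)⟩, h3 (Ideal.pow_le_pow_right (by omega) hc)⟩
  exact h

theorem isOpen_of_forall_mem {I : Ideal R} (hR : IsAdic I) {N : Subgroup (heisenbergGroup R)}
    {k : ℕ} (h : ∀ a ∈ I ^ k, ∀ b ∈ I ^ k, ∀ c ∈ I ^ k, heisenbergMk a b c ∈ N) :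
    IsOpen (N : Set (heisenbergGroup R)) := by
  have : IsTopologicalRing R := by rw [hR]; infer_instance
  have hval : Continuous fun g : heisenbergGroup R =>
      (g : Matrix.SpecialLinearGroup (Fin 3) R) := continuous_subtype_val
  have hval' : Continuous fun g : Matrix.SpecialLinearGroup (Fin 3) R => g.1 :=
    continuous_subtype_val
  have hcont : ∀ i j, Continuous fun g : heisenbergGroup R => g.1.1 i j := fun i j =>
    (hval'.comp hval).matrix_elem i j
  have hopen : IsOpen {g : heisenbergGroup R | g.1.1 0 1 ∈ I ^ k ∧ g.1.1 1 2 ∈ I ^ k ∧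
      g.1.1 0 2 ∈ I ^ k} :=
    ((isOpen_of_isAdic hR k).preimage (hcont 0 1)).inter
      (((isOpen_of_isAdic hR k).preimage (hcont 1 2)).inter
        ((isOpen_of_isAdic hR k).preimage (hcont 0 2)))
  refine N.isOpen_of_mem_nhds (g := 1) (Filter.mem_of_superset (hopen.mem_nhds ?_) ?_)
  · exact ⟨by simp, by simp, by simp⟩
  · rintro g ⟨h1, h2, h3⟩
    have := h _ h1 _ h2 _ h3
    rwa [← (heisenbergEquiv R).left_inv g]

/-- The open normal subgroups of a topological group. -/
abbrev OpenNormalSubgroups (G : Type*) [Group G] [TopologicalSpace G] : Type _ :=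
  {N : Subgroup G // N.Normal ∧ IsOpen (N : Set G)}

variable [IsDomain R] [IsDiscreteValuationRing R] [Algebra ℤ_[p] R] {e : ℕ}

/-- In coordinates the open normal subgroups of the Heisenberg group are the Heisenberg lattices. -/
theorem exists_openNormalEquiv (hR : IsAdic (maximalIdeal R))
    (he : Ideal.span {(p : R)} = maximalIdeal R ^ e) (he0 : e ≠ 0) :
    ∃ E : HeisenbergLattices p R ≃ OpenNormalSubgroups (heisenbergGroup R),
      ∀ N, (E N).1.index = Nat.card (((R × R) × R) ⧸ N.1.1) := by
  refine ⟨Equiv.ofBijective (fun N => ⟨subgroupOfAdditive N.1.1.toAddSubgroup N.2,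
    normal_subgroupOfAdditive _, ?_⟩) ⟨?_, ?_⟩, fun N => index_subgroupOfAdditive N.2⟩
  · obtain ⟨⟨N, k, hk⟩, hN⟩ := N
    refine isOpen_of_forall_mem hR (k := e * k) fun a ha b hb c hc => ?_
    obtain ⟨a, rfl⟩ := pow_smul_mem_of_mem_pow he ha
    obtain ⟨b, rfl⟩ := pow_smul_mem_of_mem_pow he hb
    obtain ⟨c, rfl⟩ := pow_smul_mem_of_mem_pow he hc
    exact hk ((a, b), c)
  · intro N N' h
    have h' : subgroupOfAdditive N.1.1.toAddSubgroup N.2 =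
      subgroupOfAdditive N'.1.1.toAddSubgroup N'.2 := congrArg Subtype.val h
    refine Subtype.ext (Subtype.ext ?_)
    ext ⟨⟨a, b⟩, c⟩
    have h1 := SetLike.ext_iff.1 h' (heisenbergMk a b c)
    exact h1
  · rintro ⟨N, hN, hopen⟩
    set A := additiveSubgroupOfNormal N hN with hA
    have hmem : ∀ a b c, ((a, b), c) ∈ A ↔ heisenbergMk a b c ∈ N := fun _ _ _ => Iff.rfl
    obtain ⟨k, hk⟩ := exists_forall_mem_of_isOpen hR hopen
    have hkA : ∀ w : (R × R) × R, (p : ℤ_[p]) ^ k • w ∈ A := by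
      rintro ⟨⟨a, b⟩, c⟩
      have h1 : ∀ y : R, (p : ℤ_[p]) ^ k • y ∈ maximalIdeal R ^ k := fun y =>
        Ideal.pow_le_pow_right (Nat.le_mul_of_pos_left k (Nat.pos_of_ne_zero he0))
          (pow_smul_mem_pow_mul he k y)
      exact hk _ (h1 a) _ (h1 b) _ (h1 c)
    refine ⟨⟨⟨{ A with smul_mem' := fun c w hw => smul_mem_of_pow_smul_mem A hkA c hw }, k, hkA⟩,
      ?_⟩, Subtype.ext ?_⟩
    · rintro ⟨⟨a, b⟩, c⟩ hw r
      have h1 := central_mem_of_normal hN ((hmem a b c).1 hw) 0 (-r)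
      have h2 := central_mem_of_normal hN ((hmem a b c).1 hw) r 0
      rw [zero_mul, zero_sub, neg_mul, neg_neg] at h1
      rw [zero_mul, sub_zero] at h2
      exact ⟨h1, h2⟩
    · ext h
      obtain ⟨a, b, c, rfl⟩ := heisenbergMk_surjective h
      exact Iff.rfl

/-- The open subgroups of `ℤ_[p]ⁿ` are the lattices. -/
theorem exists_openNormalEquiv_pi (p : ℕ) [hp : Fact p.Prime] (n : ℕ) :
    ∃ E : Lattices p (Fin n → ℤ_[p]) ≃ OpenNormalSubgroups (Multiplicative (Fin n → ℤ_[p])),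
      ∀ L, (E L).1.index = Nat.card ((Fin n → ℤ_[p]) ⧸ L.1) := by
  have hpp : 0 < p := hp.out.pos
  refine ⟨Equiv.ofBijective (fun L => ⟨AddSubgroup.toSubgroup L.1.toAddSubgroup, inferInstance,
    ?_⟩) ⟨?_, ?_⟩, fun L => AddSubgroup.index_toSubgroup _⟩
  · obtain ⟨L, k, hk⟩ := L
    change IsOpen (L.toAddSubgroup : Set (Fin n → ℤ_[p]))
    have hpos : (0 : ℝ) < (p : ℝ) ^ (-k : ℤ) := zpow_pos (by exact_mod_cast hpp) _
    refine AddSubgroup.isOpen_of_mem_nhds _ (g := 0)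
      (Filter.mem_of_superset (Metric.ball_mem_nhds 0 hpos) fun v hv => ?_)
    rw [mem_ball_zero_iff] at hv
    have hdvd : ∀ i, (p : ℤ_[p]) ^ k ∣ v i := fun i => by
      rw [← Ideal.mem_span_singleton, ← PadicInt.norm_le_pow_iff_mem_span_pow]
      exact (norm_le_pi_norm v i).trans hv.le
    choose w hw using hdvd
    have : v = (p : ℤ_[p]) ^ k • w := funext hw
    rw [this]
    exact hk w
  · intro L L' h
    have h' := congrArg Subtype.val h
    exact Subtype.ext (Submodule.toAddSubgroup_injective (AddSubgroup.toSubgroup.injective h'))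
  · rintro ⟨N, hN, hopen⟩
    set A := Subgroup.toAddSubgroup' N with hA
    have hopenA : IsOpen (A : Set (Fin n → ℤ_[p])) := hopen
    obtain ⟨ε, hε, hball⟩ := Metric.isOpen_iff.1 hopenA 0 A.zero_mem
    obtain ⟨k, hk⟩ := PadicInt.exists_pow_neg_lt p hε
    have hkA : ∀ x : Fin n → ℤ_[p], (p : ℤ_[p]) ^ k • x ∈ A := fun x => by
      refine hball ?_
      rw [mem_ball_zero_iff]
      refine lt_of_le_of_lt ((pi_norm_le_iff_of_nonneg (zpow_nonneg (by positivity) _)).2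
        fun i => ?_) hk
      rw [PadicInt.norm_le_pow_iff_mem_span_pow, Ideal.mem_span_singleton]
      exact Dvd.intro _ rfl
    exact ⟨⟨{ A with smul_mem' := fun c w hw => smul_mem_of_pow_smul_mem A hkA c hw }, k, hkA⟩,
      Subtype.ext (SetLike.ext fun x => Iff.rfl)⟩

end Heisenberg

/-! ### Zeta functions as sums over lattices -/

section Zeta

open IsLocalRing Finset

/-- A convergent sum over all open normal subgroups makes the counting function finite and gives
the normal zeta function. -/
theorem lseriesHasSum_normalCoeff {G : Type*} [Group G] [TopologicalSpace G] {s S : ℂ}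
    (h0 : ∀ N : OpenNormalSubgroups G, N.1.index ≠ 0)
    (h : HasSum (fun N : OpenNormalSubgroups G => (N.1.index : ℂ) ^ (-s)) S) :
    (∀ m : ℕ, m ≠ 0 → (openNormalSubgroups G m).Finite) ∧
      LSeriesHasSum (normalCoeff G) s S := by
  set ind : OpenNormalSubgroups G → ℕ := fun N => N.1.index with hind
  have E : ∀ m, {N : OpenNormalSubgroups G // ind N = m} ≃ openNormalSubgroups G m := fun m =>
    { toFun := fun N => ⟨N.1.1, N.1.2.1, N.1.2.2, N.2⟩
      invFun := fun N => ⟨⟨N.1, N.2.1, N.2.2.1⟩, N.2.2.2⟩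
      left_inv := fun _ => rfl
      right_inv := fun _ => rfl }
  have hconst : ∀ m, (fun N : {N : OpenNormalSubgroups G // ind N = m} =>
      (N.1.1.index : ℂ) ^ (-s)) = fun _ => (m : ℂ) ^ (-s) := fun m => by
    funext N
    exact congrArg (fun k : ℕ => (k : ℂ) ^ (-s)) N.2
  -- the terms of a fibre are equal and nonzero, so that the fibre is finite
  have hfin : ∀ m : ℕ, m ≠ 0 → Finite {N : OpenNormalSubgroups G // ind N = m} := by
    intro m hm
    by_contra hinf
    rw [not_finite_iff_infinite] at hinf
    have h1 := (h.summable.comp_injective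
      (Subtype.val_injective (p := fun N => ind N = m))).tendsto_cofinite_zero
    have h2 : (fun N : OpenNormalSubgroups G => (N.1.index : ℂ) ^ (-s)) ∘ Subtype.val =
      fun _ : {N : OpenNormalSubgroups G // ind N = m} => (m : ℂ) ^ (-s) := hconst m
    rw [h2] at h1
    have h3 := tendsto_nhds_unique h1 tendsto_const_nhds
    rw [eq_comm, Complex.cpow_eq_zero_iff] at h3
    exact hm (by exact_mod_cast h3.1)
  refine ⟨fun m hm => ?_, ?_⟩
  · have := hfin m hm
    have := Finite.of_equiv _ (E m)
    exact Set.toFinite _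
  · rw [← (Equiv.sigmaFiberEquiv ind).hasSum_iff] at h
    refine h.sigma fun m => ?_
    change HasSum (fun N : {N : OpenNormalSubgroups G // ind N = m} =>
      (N.1.1.index : ℂ) ^ (-s)) _
    rw [hconst m]
    rcases Nat.eq_zero_or_pos m with rfl | hm
    · have : IsEmpty {N : OpenNormalSubgroups G // ind N = 0} := ⟨fun N => h0 N.1 N.2⟩
      rw [LSeries.term_zero]
      exact hasSum_empty
    · have := hfin m hm.ne'
      have := Fintype.ofFinite {N : OpenNormalSubgroups G // ind N = m}
      have h1 := hasSum_fintype fun _ : {N : OpenNormalSubgroups G // ind N = m} => (m : ℂ) ^ (-s)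
      rw [Finset.sum_const, Finset.card_univ, ← Nat.card_eq_fintype_card,
        Nat.card_congr (E m), nsmul_eq_mul] at h1
      rw [LSeries.term_of_ne_zero hm.ne', normalCoeff, normalCount, ← Nat.card_coe_set_eq,
        div_eq_mul_inv, ← Complex.cpow_neg]
      exact h1

theorem hasSum_mul_prod {α β : Type*} {f : α → ℂ} {g : β → ℂ} {S T : ℂ} (hf : HasSum f S)
    (hg : HasSum g T) : HasSum (fun x : α × β => f x.1 * g x.2) (S * T) := by
  have h := (summable_mul_of_summable_norm hf.summable.norm hg.summable.norm).hasSum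
  rwa [← tsum_mul_tsum_of_summable_norm hf.summable.norm hg.summable.norm, hf.tsum_eq,
    hg.tsum_eq] at h

theorem natCast_pow_cpow (a v : ℕ) (w : ℂ) : ((a ^ v : ℕ) : ℂ) ^ w = ((a : ℂ) ^ w) ^ v := by
  induction v with
  | zero => simp
  | succ v ih => rw [pow_succ, Nat.cast_mul, Complex.natCast_mul_natCast_cpow, ih, pow_succ]

variable {p : ℕ} [hp : Fact p.Prime]

/-- Transport of lattices along a linear equivalence. -/
noncomputable def latticesCongr {M M' : Type*} [AddCommGroup M] [Module ℤ_[p] M] [AddCommGroup M']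
    [Module ℤ_[p] M'] (Φ : M ≃ₗ[ℤ_[p]] M') : Lattices p M ≃ Lattices p M' where
  toFun L := ⟨L.1.map Φ.toLinearMap, L.2.imp fun k hk x => ⟨_, hk (Φ.symm x), by simp⟩⟩
  invFun L := ⟨L.1.map Φ.symm.toLinearMap, L.2.imp fun k hk x => ⟨_, hk (Φ x), by simp⟩⟩
  left_inv L := Subtype.ext <| by
    ext x
    simp
  right_inv L := Subtype.ext <| by
    ext x
    simp

theorem card_quotient_latticesCongr {M M' : Type*} [AddCommGroup M] [Module ℤ_[p] M]
    [AddCommGroup M'] [Module ℤ_[p] M'] (Φ : M ≃ₗ[ℤ_[p]] M') (L : Lattices p M) :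
    Nat.card (M' ⧸ (latticesCongr Φ L).1) = Nat.card (M ⧸ L.1) :=
  (Nat.card_congr (Submodule.Quotient.equiv L.1 _ Φ rfl).toEquiv).symm

theorem card_quotient_lattice_ne_zero {n : ℕ} (hn : 0 < n) (L : Lattices p (Fin n → ℤ_[p])) :
    Nat.card ((Fin n → ℤ_[p]) ⧸ L.1) ≠ 0 := by
  obtain ⟨L, k, hk⟩ := L
  obtain ⟨a, ha⟩ := exists_hasType hk
  rw [ha.card_quotient hn]
  exact pow_ne_zero _ hp.out.ne_zero

theorem norm_cpow_lt_one {w : ℂ} (hw : w.re < 0) : ‖(p : ℂ) ^ w‖ < 1 := by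
  rw [Complex.norm_natCast_cpow_of_pos hp.out.pos]
  exact Real.rpow_lt_one_of_one_lt_of_neg (by exact_mod_cast hp.out.one_lt) hw

/-- The sum over the lattices of `ℤ_[p]ⁿ` of the inverse powers of the indices converges to the
right of `n - 1`. -/
theorem exists_hasSum_card_cpow {n : ℕ} (hn : 0 < n) {s : ℂ} (hs : (n : ℝ) - 1 < s.re) :
    ∃ Z, HasSum (fun L : Lattices p (Fin n → ℤ_[p]) =>
      (Nat.card ((Fin n → ℤ_[p]) ⧸ L.1) : ℂ) ^ (-s)) Z := by
  obtain ⟨m, rfl⟩ := Nat.exists_eq_succ_of_ne_zero hn.ne'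
  have hp0 : (p : ℂ) ≠ 0 := by exact_mod_cast hp.out.ne_zero
  -- for `y = 1` the invariant that depends on `e` and `f` is not recorded
  refine ⟨_, hasSum_lattices (e := m + 1) (f := 1) (by ring) (z := (p : ℂ) ^ (-s)) (y := 1)
    one_ne_zero (X := fun l => (p : ℂ) ^ (l * (m + 1 - l)) * ((p : ℂ) ^ (-s)) ^ (m + 1 - l) *
      1 ^ (m + 1)) (fun l => rfl) (fun l => ?_) fun L v c hv _ => ?_⟩
  · have hl := Nat.lt_succ_iff.1 l.2
    have h1 : (p : ℂ) ^ ((l : ℕ) * (m + 1 - l)) * ((p : ℂ) ^ (-s)) ^ (m + 1 - (l : ℕ)) *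
        1 ^ (m + 1) = (p : ℂ) ^ (((m : ℂ) + 1 - l) * (l - s)) := by
      rw [← Complex.cpow_natCast, ← Complex.cpow_nat_mul, ← Complex.cpow_add _ _ hp0, one_pow,
        mul_one]
      congr 1
      rw [Nat.cast_mul, Nat.cast_sub (by omega)]
      push_cast
      ring
    rw [h1]
    refine norm_cpow_lt_one ?_
    have h2 : (((m : ℂ) + 1 - l) * (l - s)).re = ((m : ℝ) + 1 - l) * (l - s.re) := by
      simp [Complex.mul_re]
    rw [h2]
    have h3 : ((l : ℕ) : ℝ) ≤ m := by exact_mod_cast hl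
    push_cast at hs
    exact mul_neg_of_pos_of_neg (by linarith) (by linarith)
  · rw [hv, natCast_pow_cpow, one_pow, mul_one]

variable {R : Type*} [CommRing R] [IsDomain R] [IsDiscreteValuationRing R] [Algebra ℤ_[p] R]
  {e f : ℕ}

theorem card_quotient_pow [Module.Finite ℤ_[p] R] (hf : f = (maximalIdeal R).inertiaDeg ℤ_[p])
    (c : ℕ) :
    Nat.card (R ⧸ maximalIdeal R ^ c) = p ^ (f * c) := by
  have := liesOver_maximalIdeal (p := p) (R := R)
  have hfr := Ideal.inertiaDeg_eq_of_isMaximal (maximalIdeal ℤ_[p]) (maximalIdeal R)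
  let : Field (ℤ_[p] ⧸ maximalIdeal ℤ_[p]) := Ideal.Quotient.field _
  have : Module.Finite (ℤ_[p] ⧸ maximalIdeal ℤ_[p]) (R ⧸ maximalIdeal R) :=
    Module.Finite.of_restrictScalars_finite ℤ_[p] _ _
  have h1 := Module.natCard_eq_pow_finrank (K := ℤ_[p] ⧸ maximalIdeal ℤ_[p])
    (V := R ⧸ maximalIdeal R)
  have h2 : Nat.card (ℤ_[p] ⧸ maximalIdeal ℤ_[p]) = p :=
    (Nat.card_congr PadicInt.residueField.toEquiv).trans (Nat.card_zmod p)
  rw [h2, ← hfr, ← hf] at h1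
  have h3 := cardQuot_pow_of_prime (P := maximalIdeal R)
    (IsDiscreteValuationRing.not_a_field R) (i := c)
  rw [Submodule.cardQuot_apply, Submodule.cardQuot_apply, h1, ← pow_mul] at h3
  exact h3

/-- Coordinates on the squares of the powers of the maximal ideal. -/
theorem exists_square_coordinates {n : ℕ} (Φ : (Fin n → ℤ_[p]) ≃ₗ[ℤ_[p]] R) :
    ∃ θ : ℕ → (Fin (2 * n) → ℤ_[p]) →ₗ[ℤ_[p]] R × R, (∀ c, Function.Injective (θ c)) ∧
      ∀ c u, (∃ v, θ c v = u) ↔ u.1 ∈ maximalIdeal R ^ c ∧ u.2 ∈ maximalIdeal R ^ c := by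
  obtain ⟨π, hπ⟩ := IsDiscreteValuationRing.exists_irreducible R
  have hspan : ∀ c, maximalIdeal R ^ c = Ideal.span {π ^ c} := fun c => by
    rw [hπ.maximalIdeal_eq, Ideal.span_singleton_pow]
  have : Module.Free ℤ_[p] R := Module.Free.of_equiv Φ
  have : Module.Finite ℤ_[p] R := Module.Finite.equiv Φ
  have hfr : Module.finrank ℤ_[p] R = n := by rw [← Φ.finrank_eq]; simp
  let Ψ : (Fin (2 * n) → ℤ_[p]) ≃ₗ[ℤ_[p]] R × R :=
    LinearEquiv.ofFinrankEq _ _ (by rw [Module.finrank_prod, hfr]; simp [two_mul])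
  refine ⟨fun c => ((LinearMap.mulLeft ℤ_[p] (π ^ c)).prodMap
    (LinearMap.mulLeft ℤ_[p] (π ^ c))) ∘ₗ Ψ.toLinearMap, fun c => ?_, fun c u => ?_⟩
  · have hinj : Function.Injective (LinearMap.mulLeft ℤ_[p] (π ^ c)) :=
      mul_right_injective₀ (pow_ne_zero _ hπ.ne_zero)
    exact (Function.Injective.prodMap hinj hinj).comp Ψ.injective
  · rw [hspan, Ideal.mem_span_singleton, Ideal.mem_span_singleton]
    constructor
    · rintro ⟨v, rfl⟩
      exact ⟨Dvd.intro _ rfl, Dvd.intro _ rfl⟩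
    · rintro ⟨⟨a, ha⟩, ⟨b, hb⟩⟩
      exact ⟨Ψ.symm (a, b), Prod.ext (by simp [ha]) (by simp [hb])⟩

theorem card_quotient_range [Module.Finite ℤ_[p] R]
    (hf : f = (maximalIdeal R).inertiaDeg ℤ_[p]) {V : Type*}
    [AddCommGroup V] [Module ℤ_[p] V] {θ : V →ₗ[ℤ_[p]] R × R} {c : ℕ}
    (hrange : ∀ u, (∃ v, θ v = u) ↔ u.1 ∈ maximalIdeal R ^ c ∧ u.2 ∈ maximalIdeal R ^ c) :
    Nat.card ((R × R) ⧸ LinearMap.range θ) = p ^ (2 * f * c) := by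
  have h1 : (LinearMap.range θ).toAddSubgroup =
      (Submodule.toAddSubgroup (maximalIdeal R ^ c)).prod
        (Submodule.toAddSubgroup (maximalIdeal R ^ c)) := by
    ext u
    exact hrange u
  have h2 : (Submodule.toAddSubgroup (maximalIdeal R ^ c)).index = p ^ (f * c) :=
    card_quotient_pow hf c
  change (LinearMap.range θ).toAddSubgroup.index = _
  rw [h1, AddSubgroup.index_prod, h2, ← pow_add]
  congr 1
  ring

theorem numericalDatum_eq {n : ℕ} (hn : n = e * f) (s : ℂ) {l : ℕ} (hl : l ≤ n) :
    numericalDatum p n s l = (p : ℂ) ^ (l * (n - l)) *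
      ((p : ℂ) ^ (2 * (n : ℂ) - s)) ^ (n - l) * ((p : ℂ) ^ (-(2 * (f : ℂ) * s))) ^ e := by
  have hp0 : (p : ℂ) ≠ 0 := by exact_mod_cast hp.out.ne_zero
  rw [numericalDatum, ← Complex.cpow_natCast, ← Complex.cpow_nat_mul, ← Complex.cpow_nat_mul,
    ← Complex.cpow_add _ _ hp0, ← Complex.cpow_add _ _ hp0]
  congr 1
  have : (n : ℂ) = e * f := by rw [hn]; push_cast; rfl
  rw [Nat.cast_mul, Nat.cast_sub hl]
  linear_combination (-(2 * s)) * this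

theorem norm_numericalDatum_lt_one {n : ℕ} {s : ℂ} (hs : 2 * (n : ℝ) - 1 < s.re) {l : ℕ}
    (hl : l < n) : ‖numericalDatum p n s l‖ < 1 := by
  refine norm_cpow_lt_one ?_
  have h1 : ((2 * (n : ℂ) + l) * ((n : ℂ) - l) - (3 * (n : ℂ) - l) * s).re =
      (2 * (n : ℝ) + l) * (n - l) - (3 * n - l) * s.re := by
    simp [Complex.mul_re]
  rw [h1]
  have h2 : (l : ℝ) + 1 ≤ n := by exact_mod_cast hl
  have h3 : (0 : ℝ) ≤ l := Nat.cast_nonneg l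
  have h4 : (3 * (n : ℝ) - l) * (2 * n - 1) < (3 * n - l) * s.re :=
    mul_lt_mul_of_pos_left hs (by linarith)
  have h5 : (2 * (n : ℝ) + l) * (n - l) ≤ (3 * n - l) * (2 * n - 1) := by
    nlinarith [mul_nonneg h3 h3, mul_nonneg h3 (by linarith : (0 : ℝ) ≤ n - l - 1),
      mul_nonneg (by linarith : (0 : ℝ) ≤ n - l - 1) (by linarith : (0 : ℝ) ≤ n - l - 1)]
  linarith

/-- The factor contributed by the intersections `L` of the normal subgroups with the centre. For
each `L` it combines the number `[R : L] ^ (2 * n)` of gluing maps with the powers of the index of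
`L` and of the index of the square of the largest ideal contained in `L`. -/
theorem hasSum_center
    (he : Ideal.span {(p : R)} = maximalIdeal R ^ e)
    {n : ℕ} (hn : n = e * f) (hn0 : 0 < n) (Φ : (Fin n → ℤ_[p]) ≃ₗ[ℤ_[p]] R)
    (hΦ : ∀ x K, Φ x ∈ maximalIdeal R ^ K ↔ x ∈ latticeChain p n (f * K))
    {s : ℂ} (hs : 2 * (n : ℝ) - 1 < s.re) :
    HasSum (fun L : Lattices p R => (Nat.card (R ⧸ L.1) : ℂ) ^ (2 * n) *
      (Nat.card (R ⧸ L.1) : ℂ) ^ (-s) * ((p ^ (2 * f * conductorExponent L.1) : ℕ) : ℂ) ^ (-s))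
      ((∑ w : Equiv.Perm (Fin n), (p : ℂ) ^ (-(coxeterLength w : ℂ) +
          2 * (f : ℂ) * ((lastParabolicLength w / f : ℕ) : ℂ) * s) *
          ∏ j ∈ descentSet w, numericalDatum p n s ((j : ℕ) + 1)) /
        ∏ i ∈ Finset.range n, (1 - numericalDatum p n s i)) := by
  obtain ⟨m, rfl⟩ := Nat.exists_eq_succ_of_ne_zero hn0.ne'
  have hp0 : (p : ℂ) ≠ 0 := by exact_mod_cast hp.out.ne_zero
  have hsum : ∀ w : Equiv.Perm (Fin (m + 1)), (p : ℂ) ^ (-(coxeterLength w : ℂ) +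
      2 * (f : ℂ) * ((lastParabolicLength w / f : ℕ) : ℂ) * s) =
        (p : ℂ)⁻¹ ^ coxeterLength w *
          ((p : ℂ) ^ (-(2 * (f : ℂ) * s)))⁻¹ ^ (lastParabolicLength w / f) := fun w => by
    rw [← Complex.cpow_neg, neg_neg, ← Complex.cpow_nat_mul, inv_pow, ← Complex.cpow_natCast,
      ← Complex.cpow_neg, ← Complex.cpow_add _ _ hp0]
    congr 1
    ring
  simp only [hsum]
  rw [← (latticesCongr Φ).hasSum_iff]
  refine hasSum_lattices hn (z := (p : ℂ) ^ (2 * ((m + 1 : ℕ) : ℂ) - s)) (by simp [hp0])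
    (fun l => numericalDatum_eq hn s l.2.le)
    (fun l => norm_numericalDatum_lt_one hs l.2) fun L v c hv hc => ?_
  have hcard : Nat.card (R ⧸ (latticesCongr Φ L).1) = p ^ v := by
    rw [card_quotient_latticesCongr, hv]
  have hcond : conductorExponent (latticesCongr Φ L).1 = c := by
    refine eq_of_forall_ge_iff fun c' => ?_
    rw [← forall_mem_pow_iff he, ← hc]
    constructor
    · intro h x hx
      obtain ⟨y, hy, hxy⟩ := h _ ((hΦ x c').2 hx)
      rwa [← Φ.injective hxy]
    · intro h x hx
      refine ⟨Φ.symm x, h ((hΦ _ c').1 ?_), Φ.apply_symm_apply x⟩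
      rwa [Φ.apply_symm_apply]
  simp only [Function.comp_apply]
  rw [hcard, hcond, natCast_pow_cpow, natCast_pow_cpow, Nat.cast_pow, sub_eq_add_neg,
    Complex.cpow_add _ _ hp0, mul_pow, ← Complex.cpow_nat_mul, ← Complex.cpow_nat_mul,
    ← Complex.cpow_nat_mul, ← Complex.cpow_nat_mul, ← pow_mul, ← Complex.cpow_natCast]
  congr 1
  · congr 1
    congr 1
    push_cast
    ring
  · congr 1
    push_cast
    ring

/-- The sum over the open normal subgroups of the Heisenberg group factors: a lattice `L` in `R` and
a lattice `Λ` in `ℤ_[p] ^ (2 * n)` contribute `[R : L] ^ (2 * n)` subgroups, all of index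
`[R : L] [ℤ_[p] ^ (2 * n) : Λ] p ^ (2 * f * c)`, where `c` is the conductor exponent of `L`. -/
theorem hasSum_heisenberg [Module.Finite ℤ_[p] R] [TopologicalSpace R]
    (hR : IsAdic (maximalIdeal R))
    (he : Ideal.span {(p : R)} = maximalIdeal R ^ e) (he0 : e ≠ 0)
    (hf : f = (maximalIdeal R).inertiaDeg ℤ_[p]) {n : ℕ} (hn0 : 0 < n)
    (Φ : (Fin n → ℤ_[p]) ≃ₗ[ℤ_[p]] R) {s S Z : ℂ}
    (hS : HasSum (fun L : Lattices p R => (Nat.card (R ⧸ L.1) : ℂ) ^ (2 * n) *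
      (Nat.card (R ⧸ L.1) : ℂ) ^ (-s) *
        ((p ^ (2 * f * conductorExponent L.1) : ℕ) : ℂ) ^ (-s)) S)
    (hZ : HasSum (fun L : Lattices p (Fin (2 * n) → ℤ_[p]) =>
      (Nat.card ((Fin (2 * n) → ℤ_[p]) ⧸ L.1) : ℂ) ^ (-s)) Z) :
    (∀ N : OpenNormalSubgroups (heisenbergGroup R), N.1.index ≠ 0) ∧
    HasSum (fun N : OpenNormalSubgroups (heisenbergGroup R) => (N.1.index : ℂ) ^ (-s))
      (S * Z) := by
  have hpp := hp.out.pos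
  obtain ⟨θ, hinj, hrange⟩ := exists_square_coordinates Φ
  obtain ⟨E₁, hE₁⟩ := exists_openNormalEquiv hR he he0
  obtain ⟨E₂, hE₂⟩ := exists_gluingEquiv he he0 hinj hrange
  have hindex : ∀ x, (E₁ (E₂ x)).1.index = Nat.card (R ⧸ x.1.1.1) *
      (Nat.card ((Fin (2 * n) → ℤ_[p]) ⧸ x.1.2.1) *
        p ^ (2 * f * conductorExponent x.1.1.1)) := fun x => by
    rw [hE₁, hE₂, card_quotient_graphSubmodule (hinj _), card_quotient_range hf (hrange _)]
  have hcardR : ∀ L : Lattices p R, Nat.card (R ⧸ L.1) ≠ 0 := fun L => by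
    obtain ⟨L, rfl⟩ := (latticesCongr Φ).surjective L
    rw [card_quotient_latticesCongr]
    exact card_quotient_lattice_ne_zero hn0 L
  have hcardV : ∀ L : Lattices p (Fin (2 * n) → ℤ_[p]),
      Nat.card ((Fin (2 * n) → ℤ_[p]) ⧸ L.1) ≠ 0 :=
    card_quotient_lattice_ne_zero (by omega)
  constructor
  · intro N
    obtain ⟨x, rfl⟩ := (E₂.trans E₁).surjective N
    change (E₁ (E₂ x)).1.index ≠ 0
    rw [hindex]
    exact mul_ne_zero (hcardR _) (mul_ne_zero (hcardV _) (pow_ne_zero _ hpp.ne'))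
  · rw [← (E₂.trans E₁).hasSum_iff]
    let g : Lattices p R × Lattices p (Fin (2 * n) → ℤ_[p]) → ℂ := fun x =>
      ((Nat.card (R ⧸ x.1.1) * (Nat.card ((Fin (2 * n) → ℤ_[p]) ⧸ x.2.1) *
        p ^ (2 * f * conductorExponent x.1.1)) : ℕ) : ℂ) ^ (-s)
    have hfun : (fun N : OpenNormalSubgroups (heisenbergGroup R) => (N.1.index : ℂ) ^ (-s)) ∘
        (E₂.trans E₁) = fun x => g x.1 := by
      funext x
      simp only [Function.comp_apply, Equiv.trans_apply, hindex, g]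
    rw [hfun]
    have hcardHom : ∀ x : Lattices p R × Lattices p (Fin (2 * n) → ℤ_[p]),
        Nat.card (x.2.1 →ₗ[ℤ_[p]] R ⧸ x.1.1) = Nat.card (R ⧸ x.1.1) ^ (2 * n) := fun x =>
      natCard_linearMap_of_lattice x.2 _
    have : ∀ x : Lattices p R × Lattices p (Fin (2 * n) → ℤ_[p]),
        Fintype (x.2.1 →ₗ[ℤ_[p]] R ⧸ x.1.1) := fun x => by
      have := Nat.finite_of_card_ne_zero (α := (x.2.1 →ₗ[ℤ_[p]] R ⧸ x.1.1)) (by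
        rw [hcardHom]; exact pow_ne_zero _ (hcardR _))
      exact Fintype.ofFinite _
    refine hasSum_sigma_const ((hasSum_mul_prod hS hZ).congr_fun fun x => ?_)
    rw [← Nat.card_eq_fintype_card, hcardHom]
    simp only [g, Nat.cast_mul]
    rw [← Nat.cast_mul, Complex.natCast_mul_natCast_cpow, Nat.cast_mul,
      Complex.natCast_mul_natCast_cpow]
    push_cast
    ring

end Zeta

theorem mainTheorem1 (p : ℕ) [Fact p.Prime]
    (R : Type*) [CommRing R] [IsDomain R] [IsDiscreteValuationRing R]
    [Algebra ℤ_[p] R] [FaithfulSMul ℤ_[p] R] [Module.Finite ℤ_[p] R]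
    [TopologicalSpace R] (hR : IsAdic (IsLocalRing.maximalIdeal R))
    (e f n : ℕ)
    (he : Ideal.span {(p : R)} = IsLocalRing.maximalIdeal R ^ e)
    (hf : f = (IsLocalRing.maximalIdeal R).inertiaDeg ℤ_[p])
    (hn : n = e * f) :
    (∀ m : ℕ, m ≠ 0 → (openNormalSubgroups (heisenbergGroup R) m).Finite) ∧
    ∀ s : ℂ, 2 * (n : ℝ) - 1 < s.re →
      LSeriesSummable (normalCoeff (heisenbergGroup R)) s ∧
      LSeriesSummable (normalCoeff (Multiplicative (Fin (2 * n) → ℤ_[p]))) s ∧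
      (∀ i < n, 1 - numericalDatum p n s i ≠ 0) ∧
      normalZeta (heisenbergGroup R) s =
        normalZeta (Multiplicative (Fin (2 * n) → ℤ_[p])) s *
          ((∑ w : Equiv.Perm (Fin n),
              (p : ℂ) ^ (-(coxeterLength w : ℂ) +
                2 * (f : ℂ) * ((lastParabolicLength w / f : ℕ) : ℂ) * s) *
              ∏ j ∈ descentSet w, numericalDatum p n s ((j : ℕ) + 1)) /
            ∏ i ∈ Finset.range n, (1 - numericalDatum p n s i)) := by
  have he0 : e ≠ 0 := by
    rintro rfl
    rw [pow_zero, Ideal.one_eq_top] at he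
    have h1 := natCast_p_mem_maximalIdeal (p := p) (R := R)
    rw [← Ideal.span_singleton_le_iff_mem, he, top_le_iff] at h1
    exact (IsLocalRing.maximalIdeal.isMaximal R).ne_top h1
  have hf0 : 0 < f := hf ▸ Ideal.inertiaDeg_pos _ _
  have hn0 : 0 < n := hn ▸ Nat.mul_pos (Nat.pos_of_ne_zero he0) hf0
  obtain ⟨Φ, hΦ⟩ : ∃ Φ : (Fin n → ℤ_[p]) ≃ₗ[ℤ_[p]] R,
      ∀ x K, Φ x ∈ IsLocalRing.maximalIdeal R ^ K ↔ x ∈ latticeChain p n (f * K) := by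
    subst hn
    exact exists_coordinates he hf
  have key : ∀ s : ℂ, 2 * (n : ℝ) - 1 < s.re → ∃ Z,
      HasSum (fun L : Lattices p (Fin (2 * n) → ℤ_[p]) =>
        (Nat.card ((Fin (2 * n) → ℤ_[p]) ⧸ L.1) : ℂ) ^ (-s)) Z := fun s hs =>
    exists_hasSum_card_cpow (by omega) (by push_cast; exact hs)
  have heis := fun (s : ℂ) (hs : 2 * (n : ℝ) - 1 < s.re) (Z : ℂ) hZ =>
    hasSum_heisenberg hR he he0 hf hn0 Φ (hasSum_center he hn hn0 Φ hΦ hs) (Z := Z) hZ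
  constructor
  · -- finiteness follows from convergence at a single point
    have hs : 2 * (n : ℝ) - 1 < ((2 * n : ℕ) : ℂ).re := by
      rw [Complex.natCast_re]; push_cast; linarith
    obtain ⟨Z, hZ⟩ := key _ hs
    obtain ⟨h0, h⟩ := heis _ hs Z hZ
    exact (lseriesHasSum_normalCoeff h0 h).1
  · intro s hs
    obtain ⟨Z, hZ⟩ := key s hs
    obtain ⟨h0, h⟩ := heis s hs Z hZ
    have hH := (lseriesHasSum_normalCoeff h0 h).2
    obtain ⟨E, hE⟩ := exists_openNormalEquiv_pi p (2 * n)
    have hV : LSeriesHasSum (normalCoeff (Multiplicative (Fin (2 * n) → ℤ_[p]))) s Z := by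
      refine (lseriesHasSum_normalCoeff (fun N => ?_) ?_).2
      · obtain ⟨L, rfl⟩ := E.surjective N
        rw [hE]
        exact card_quotient_lattice_ne_zero (by omega) L
      · rw [← E.hasSum_iff]
        refine hZ.congr_fun fun L => ?_
        simp only [Function.comp_apply, hE]
    refine ⟨hH.LSeriesSummable, hV.LSeriesSummable, fun i hi h1 => ?_, ?_⟩
    · have h2 := norm_numericalDatum_lt_one (p := p) hs hi
      rw [← sub_eq_zero.1 h1, norm_one] at h2
      exact lt_irrefl _ h2
    · rw [normalZeta, normalZeta, hH.LSeries_eq, hV.LSeries_eq, mul_comm]
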